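/- **Conventions.** All rings are commutative and unital. An $\ell$-algebra is an $\mathbb R$-algebra $A$ with a lattice order such that $a\le b$ implies $a+c\le b+c$, and $0\le a,b$, $0\le r\in\mathbb R$ imply $0\le ab$ and $0\le r\cdot a$. Let $\boldsymbol{ba\ell}$ be the category of $\ell$-algebras that are bounded (every $a$ satisfies $a\le n\cdot 1$ for some $n\in\mathbb N$) and archimedean (if $n\cdot a\le b$ for all $n\in\mathbb N$, then $a\le 0$), with unital $\ell$-algebra homomorphisms. Put $|a|=a\vee(-a)$, $a^+=a\vee 0$ and $\|a\|=\inf\{r\in\mathbb R : |a|\le r\cdot 1\}$ (with $\|0\|=0$ in the zero ring). Let $\boldsymbol{uba\ell}$ be the full subcategory of those $A$ whose norm is complete, and $\boldsymbol{cuba\ell}$ the full subcategory of those $A\in\boldsymbol{uba\ell}$ that are clean, i.e. every $a\in A$ is $a=e+v$ with $e$ idempotent and $v$ a unit. An $\ell$-ideal is an ideal $I$ such that $|a|\le|b|$ and $b\in I$ imply $a\in I$; it is archimedean if $A/I$ is archimedean. Let $Y_A$ be the space of maximal $\ell$-ideals of $A\in\boldsymbol{ba\ell}$, whose closed sets are the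 sets $\{M : I\subseteq M\}$ for $\ell$-ideals $I$; it is compact Hausdorff, and $Y(\alpha)=\alpha^{-1}$ makes $Y$ a contravariant functor from $\boldsymbol{ba\ell}$ to compact Hausdorff spaces. Let $C$ be the contravariant functor that sends a compact Hausdorff space $X$ to $C(X)=C(X,\mathbb R)\in\boldsymbol{uba\ell}$ and a continuous map to composition with it. For $A\in\boldsymbol{ba\ell}$ let $f_A:A\to F(A)$ be the free object of $\boldsymbol{ba\ell}$ over the weighted set $(A,w_A)$, $w_A(a)=\max\{\|a\|,1\}$; that is, $\|f_A(a)\|\le w_A(a)$ for all $a$, and each function $g:A\to B$ into some $B\in\boldsymbol{ba\ell}$ with $\|g(a)\|\le w_A(a)$ for all $a$ factors as $g=\tau\circ f_A$ for a unique morphism $\tau:F(A)\to B$. Let $I_A$ be the least archimedean $\ell$-ideal of $F(A)$ containing, for all $a,b\in A$, $r\in\mathbb R$, the elements $$f_A(a\wedge b)-f_A(a)\wedge f_A(b),\quad f_A(r)-r-(1-r)f_A(0),\quad f_A(a^+)-f_A(a)^+,$$ $$f_A(a+r)-f_A(a)-f_A(r)+f_A(0),\quad f_A(ra)-f_A(r)f_A(a)\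 \text{ if } 0\le r .$$ Put $H(A)=F(A)/I_A$ and let $h_A:A\to H(A)$ be the composite of $f_A$ with the quotient map. For $\alpha:A\to B$ let $H(\alpha)$ be the unique morphism with $H(\alpha)\circ h_A=h_B\circ\alpha$. Then $H$ is an endofunctor of $\boldsymbol{ba\ell}$, and $H^u=C\circ Y\circ H$ is an endofunctor of $\boldsymbol{uba\ell}$. Let $V^{S}$ be the Vietoris endofunctor of the category of Stone spaces (compact, Hausdorff, totally disconnected spaces): $V^S(X)$ is the set of all closed subsets of $X$, including $\varnothing$, with the topology generated by the sets $\{F : F\subseteq U\}$ and $\{F : F\cap U\neq\varnothing\}$, $U\subseteq X$ open, and $V^S(\varphi)(F)=\varphi(F)$. For an endofunctor $T$, $\mathsf{Alg}(T)$ is the category of pairs $(A,\,T(A)\to A)$ and $\mathsf{Coalg}(T)$ the category of pairs $(X,\,X\to T(X))$, with the usual morphisms. **Theorem.** 1. If $A\in\boldsymbol{cuba\ell}$, then $H^u(A)\in\boldsymbol{cuba\ell}$. Hence $H^u$ restricts to an endofunctor $H^c$ of $\boldsymbol{cuba\ell}$. 2. There is a dual equivalence between $\mathsf{Alg}(H^c)$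 and $\mathsf{Coalg}(V^S)$. It can be chosen to lift Gelfand duality: the functor $\mathsf{Alg}(H^c)^{\mathrm{op}}\to\mathsf{Coalg}(V^S)$ followed by the functor to compact Hausdorff spaces forgetting the coalgebra structure is naturally isomorphic to $(A,\sigma)\mapsto Y_A$. -/

import Mathlib

set_option linter.unusedSectionVars false

open CategoryTheory TopologicalSpace
open scoped NNReal

universe u

namespace Bal

/-! ### Bounded archimedean lattice-ordered algebras -/

/-- A commutative unital `ℝ`-algebra with a lattice order is an `ℓ`-algebra. -/
class LAlgebra (A : Type u) [CommRing A] [Lattice A] [Algebra ℝ A] : Prop where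
  add_le_add_right' : ∀ a b c : A, a ≤ b → a + c ≤ b + c
  mul_nonneg' : ∀ a b : A, 0 ≤ a → 0 ≤ b → 0 ≤ a * b
  smul_nonneg' : ∀ (r : ℝ) (a : A), 0 ≤ r → 0 ≤ a → 0 ≤ r • a

/-- A bounded `ℓ`-algebra: `1` is a strong order unit. -/
class BddLAlgebra (A : Type u) [CommRing A] [Lattice A] [Algebra ℝ A] : Prop
    extends LAlgebra A where
  bounded' : ∀ a : A, ∃ n : ℕ, a ≤ n • (1 : A)

/-- The archimedean property of a lattice-ordered ring. -/
def IsArch (A : Type u) [CommRing A] [Lattice A] : Prop :=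
  ∀ a b : A, (∀ n : ℕ, n • a ≤ b) → a ≤ 0

section Basic

variable {A : Type u} [CommRing A] [Lattice A] [Algebra ℝ A]

instance [LAlgebra A] : IsOrderedAddMonoid A where
  add_le_add_left a b h c := LAlgebra.add_le_add_right' a b c h

variable [BddLAlgebra A]

lemma zero_le_one' : (0 : A) ≤ 1 := by
  obtain ⟨n, hn⟩ := BddLAlgebra.bounded' (A := A) (-1)
  have h1 : (0 : A) ≤ ((n : ℝ) + 1) • (1 : A) := by
    have := add_le_add_left hn 1
    simpa [add_smul, ← Nat.cast_smul_eq_nsmul ℝ] using this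
  have h2 := LAlgebra.smul_nonneg' (A := A) ((n : ℝ) + 1)⁻¹ _ (by positivity) h1
  rwa [smul_smul, inv_mul_cancel₀ (by positivity), one_smul] at h2

instance : IsOrderedRing A where
  zero_le_one := zero_le_one'
  mul_le_mul_of_nonneg_left a ha b c hbc := by
    have := LAlgebra.mul_nonneg' a (c - b) ha (sub_nonneg.2 hbc)
    rw [mul_sub] at this
    exact sub_nonneg.1 this
  mul_le_mul_of_nonneg_right a ha b c hbc := by
    have := LAlgebra.mul_nonneg' (c - b) a (sub_nonneg.2 hbc) ha
    rw [sub_mul] at this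
    exact sub_nonneg.1 this

lemma algebraMap_mono {r s : ℝ} (h : r ≤ s) : algebraMap ℝ A r ≤ algebraMap ℝ A s := by
  have := LAlgebra.smul_nonneg' (A := A) (s - r) 1 (sub_nonneg.2 h) zero_le_one'
  rw [← Algebra.algebraMap_eq_smul_one, map_sub] at this
  exact sub_nonneg.1 this

lemma algebraMap_nonneg' {r : ℝ} (h : 0 ≤ r) : (0 : A) ≤ algebraMap ℝ A r := by
  simpa using algebraMap_mono (A := A) h

lemma smul_mono' {r : ℝ} (h : 0 ≤ r) {a b : A} (hab : a ≤ b) : r • a ≤ r • b := by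
  have := LAlgebra.smul_nonneg' (A := A) r (b - a) h (sub_nonneg.2 hab)
  rw [smul_sub] at this
  exact sub_nonneg.1 this

/-- every element is bounded in absolute value by a natural number `≥ 1`. -/
lemma exists_abs_le (a : A) : ∃ n : ℕ, 1 ≤ n ∧ |a| ≤ algebraMap ℝ A n := by
  obtain ⟨n, hn⟩ := BddLAlgebra.bounded' |a|
  refine ⟨n + 1, by omega, hn.trans ?_⟩
  rw [nsmul_one, ← map_natCast (algebraMap ℝ A) n]
  exact algebraMap_mono (by push_cast; linarith)

lemma abs_mul_le_of_abs_le {c : A} {r : ℝ} (hc : |c| ≤ algebraMap ℝ A r) (x : A) :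
    |c * x| ≤ algebraMap ℝ A r * |x| := by
  have key : ∀ c : A, |c| ≤ algebraMap ℝ A r → c * x ≤ algebraMap ℝ A r * |x| := by
    intro c hc
    have h1 : c * x⁺ ≤ algebraMap ℝ A r * x⁺ :=
      mul_le_mul_of_nonneg_right ((le_abs_self c).trans hc) (posPart_nonneg x)
    have h2 : -c * x⁻ ≤ algebraMap ℝ A r * x⁻ :=
      mul_le_mul_of_nonneg_right ((neg_le_abs c).trans hc) (negPart_nonneg x)
    have e1 : c * x = c * x⁺ + -c * x⁻ := by
      nth_rw 1 [← posPart_sub_negPart x]; ring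
    rw [e1, ← posPart_add_negPart x, mul_add]
    exact add_le_add h1 h2
  refine abs_le'.2 ⟨key c hc, ?_⟩
  rw [← neg_mul]
  exact key (-c) (by rwa [abs_neg])

end Basic

/-! ### `ℓ`-ideals and quotients -/

/-- An `ℓ`-ideal: an ideal `I` such that `|a| ≤ |b|` and `b ∈ I` imply `a ∈ I`. -/
structure LIdeal (A : Type u) [CommRing A] [Lattice A] where
  toIdeal : Ideal A
  solid : ∀ a b : A, |a| ≤ |b| → b ∈ toIdeal → a ∈ toIdeal

namespace LIdeal

variable {A : Type u} [CommRing A] [Lattice A]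

instance : Membership A (LIdeal A) := ⟨fun I a => a ∈ I.toIdeal⟩

lemma mem_def {I : LIdeal A} {a : A} : a ∈ I ↔ a ∈ I.toIdeal := Iff.rfl

@[ext]
lemma ext' {I J : LIdeal A} (h : ∀ a, a ∈ I ↔ a ∈ J) : I = J := by
  cases I; cases J
  congr
  exact Ideal.ext h

/-- The quotient algebra `A / I`. -/
def Quot (I : LIdeal A) : Type u := A ⧸ I.toIdeal

instance (I : LIdeal A) : CommRing I.Quot := inferInstanceAs (CommRing (A ⧸ I.toIdeal))

instance [Algebra ℝ A] (I : LIdeal A) : Algebra ℝ I.Quot :=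
  inferInstanceAs (Algebra ℝ (A ⧸ I.toIdeal))

/-- The quotient map. -/
def quo (I : LIdeal A) : A →+* I.Quot := Ideal.Quotient.mk I.toIdeal

lemma quo_surjective (I : LIdeal A) : Function.Surjective I.quo := Ideal.Quotient.mk_surjective

lemma quo_eq_quo {I : LIdeal A} {a b : A} : I.quo a = I.quo b ↔ a - b ∈ I :=
  Ideal.Quotient.eq

lemma quo_eq_zero {I : LIdeal A} {a : A} : I.quo a = 0 ↔ a ∈ I := Ideal.Quotient.eq_zero_iff_mem

lemma quo_smul [Algebra ℝ A] (I : LIdeal A) (r : ℝ) (a : A) : I.quo (r • a) = r • I.quo a := rfl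

lemma quo_algebraMap [Algebra ℝ A] (I : LIdeal A) (r : ℝ) :
    I.quo (algebraMap ℝ A r) = algebraMap ℝ I.Quot r := rfl

variable [Algebra ℝ A] [LAlgebra A]

lemma mem_of_abs_le {I : LIdeal A} {a b : A} (h : |a| ≤ b) (hb : b ∈ I) : a ∈ I :=
  I.solid a b (h.trans (le_abs_self b)) hb

lemma abs_mem {I : LIdeal A} {a : A} (h : a ∈ I) : |a| ∈ I :=
  I.solid _ a (by rw [abs_abs]) h

lemma mem_of_nonneg_le {I : LIdeal A} {a b : A} (h0 : 0 ≤ a) (h : a ≤ b) (hb : b ∈ I) : a ∈ I :=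
  mem_of_abs_le (by rwa [abs_of_nonneg h0]) hb

lemma sup_sub_sup_mem {I : LIdeal A} {a a' b b' : A} (ha : a - a' ∈ I) (hb : b - b' ∈ I) :
    a ⊔ b - a' ⊔ b' ∈ I := by
  have h1 : a ⊔ b - a' ⊔ b ∈ I := I.solid _ _ (abs_sup_sub_sup_le_abs a a' b) ha
  have h2 : a' ⊔ b - a' ⊔ b' ∈ I := by
    refine I.solid _ _ ?_ hb
    rw [sup_comm a' b, sup_comm a' b']
    exact abs_sup_sub_sup_le_abs b b' a'
  rw [← sub_add_sub_cancel]
  exact I.toIdeal.add_mem h1 h2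

lemma inf_sub_inf_mem {I : LIdeal A} {a a' b b' : A} (ha : a - a' ∈ I) (hb : b - b' ∈ I) :
    a ⊓ b - a' ⊓ b' ∈ I := by
  have h1 : a ⊓ b - a' ⊓ b ∈ I := I.solid _ _ (abs_inf_sub_inf_le_abs a a' b) ha
  have h2 : a' ⊓ b - a' ⊓ b' ∈ I := by
    refine I.solid _ _ ?_ hb
    rw [inf_comm a' b, inf_comm a' b']
    exact abs_inf_sub_inf_le_abs b b' a'
  rw [← sub_add_sub_cancel]
  exact I.toIdeal.add_mem h1 h2

/-- Join in the quotient, computed on representatives. -/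
abbrev quotMax (I : LIdeal A) : Max I.Quot where
  max := Quotient.map₂ (· ⊔ ·) fun _ _ ha _ _ hb =>
    (Submodule.quotientRel_def _).2
      (sup_sub_sup_mem (I := I) ((Submodule.quotientRel_def _).1 ha)
        ((Submodule.quotientRel_def _).1 hb))

/-- Meet in the quotient, computed on representatives. -/
abbrev quotMin (I : LIdeal A) : Min I.Quot where
  min := Quotient.map₂ (· ⊓ ·) fun _ _ ha _ _ hb =>
    (Submodule.quotientRel_def _).2
      (inf_sub_inf_mem (I := I) ((Submodule.quotientRel_def _).1 ha)
        ((Submodule.quotientRel_def _).1 hb))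

/-- The lattice operations of the quotient are computed on representatives. -/
instance (I : LIdeal A) : Lattice I.Quot :=
  @Lattice.mk' _ I.quotMax I.quotMin
    (by rintro ⟨a⟩ ⟨b⟩; exact congrArg I.quo (sup_comm a b))
    (by rintro ⟨a⟩ ⟨b⟩ ⟨c⟩; exact congrArg I.quo (sup_assoc a b c))
    (by rintro ⟨a⟩ ⟨b⟩; exact congrArg I.quo (inf_comm a b))
    (by rintro ⟨a⟩ ⟨b⟩ ⟨c⟩; exact congrArg I.quo (inf_assoc a b c))
    (by rintro ⟨a⟩ ⟨b⟩; exact congrArg I.quo (sup_inf_self (a := a) (b := b)))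
    (by rintro ⟨a⟩ ⟨b⟩; exact congrArg I.quo (inf_sup_self (a := a) (b := b)))

lemma quo_sup (I : LIdeal A) (a b : A) : I.quo (a ⊔ b) = I.quo a ⊔ I.quo b := rfl

lemma quo_inf (I : LIdeal A) (a b : A) : I.quo (a ⊓ b) = I.quo a ⊓ I.quo b := rfl

lemma quo_mono (I : LIdeal A) {a b : A} (h : a ≤ b) : I.quo a ≤ I.quo b := by
  rw [← sup_eq_right, ← quo_sup, sup_eq_right.2 h]

lemma quo_le_quo {I : LIdeal A} {a b : A} : I.quo a ≤ I.quo b ↔ a ⊔ b - b ∈ I := by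
  rw [← sup_eq_right, ← quo_sup, quo_eq_quo]

lemma exists_rep_le {I : LIdeal A} {x y : I.Quot} (h : x ≤ y) :
    ∃ a b, a ≤ b ∧ I.quo a = x ∧ I.quo b = y := by
  obtain ⟨a, rfl⟩ := I.quo_surjective x
  obtain ⟨b, rfl⟩ := I.quo_surjective y
  exact ⟨a, a ⊔ b, le_sup_left, rfl, by rw [quo_sup, sup_eq_right.2 h]⟩

lemma exists_rep_nonneg {I : LIdeal A} {x : I.Quot} (h : 0 ≤ x) : ∃ a, 0 ≤ a ∧ I.quo a = x := by
  obtain ⟨a, b, hab, ha, hb⟩ := exists_rep_le h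
  exact ⟨b - a, sub_nonneg.2 hab, by rw [map_sub, ha, hb, sub_zero]⟩

instance (I : LIdeal A) : LAlgebra I.Quot where
  add_le_add_right' x y z h := by
    obtain ⟨a, b, hab, rfl, rfl⟩ := exists_rep_le h
    obtain ⟨c, rfl⟩ := I.quo_surjective z
    rw [← map_add, ← map_add]
    exact I.quo_mono (LAlgebra.add_le_add_right' a b c hab)
  mul_nonneg' x y hx hy := by
    obtain ⟨a, ha, rfl⟩ := exists_rep_nonneg hx
    obtain ⟨b, hb, rfl⟩ := exists_rep_nonneg hy
    rw [← map_mul, ← map_zero I.quo]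
    exact I.quo_mono (LAlgebra.mul_nonneg' a b ha hb)
  smul_nonneg' r x hr hx := by
    obtain ⟨a, ha, rfl⟩ := exists_rep_nonneg hx
    rw [← quo_smul, ← map_zero I.quo]
    exact I.quo_mono (LAlgebra.smul_nonneg' r a hr ha)

instance {A : Type u} [CommRing A] [Lattice A] [Algebra ℝ A] [BddLAlgebra A] (I : LIdeal A) :
    BddLAlgebra I.Quot where
  bounded' x := by
    obtain ⟨a, rfl⟩ := I.quo_surjective x
    obtain ⟨n, hn⟩ := BddLAlgebra.bounded' a
    exact ⟨n, by simpa using I.quo_mono hn⟩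

/-- An `ℓ`-ideal `I` is archimedean if `A / I` is archimedean. -/
def IsArchimedean (I : LIdeal A) : Prop := IsArch I.Quot

lemma isArchimedean_iff {I : LIdeal A} :
    I.IsArchimedean ↔ ∀ a b : A, (∀ n : ℕ, n • a ⊔ b - b ∈ I) → a ⊔ 0 ∈ I := by
  constructor
  · intro h a b hab
    have := h (I.quo a) (I.quo b) fun n => by rw [← map_nsmul, quo_le_quo]; exact hab n
    rw [← map_zero I.quo, quo_le_quo, sub_zero] at this
    exact this
  · intro h x y hxy
    obtain ⟨a, rfl⟩ := I.quo_surjective x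
    obtain ⟨b, rfl⟩ := I.quo_surjective y
    rw [← map_zero I.quo, quo_le_quo, sub_zero]
    exact h a b fun n => by rw [← quo_le_quo, map_nsmul]; exact hxy n

/-- The archimedean `ℓ`-ideal generated by `S`: the intersection of all archimedean `ℓ`-ideals
containing `S`. -/
def archSpan (S : Set A) : LIdeal A where
  toIdeal := sInf {J | ∃ I : LIdeal A, I.IsArchimedean ∧ (∀ s ∈ S, s ∈ I) ∧ I.toIdeal = J}
  solid a b hab hb := by
    rw [Submodule.mem_sInf] at hb ⊢
    rintro _ ⟨I, hI, hS, rfl⟩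
    exact I.solid a b hab (hb _ ⟨I, hI, hS, rfl⟩)

lemma mem_archSpan {S : Set A} {a : A} :
    a ∈ archSpan S ↔ ∀ I : LIdeal A, I.IsArchimedean → (∀ s ∈ S, s ∈ I) → a ∈ I := by
  change a ∈ (sInf _ : Ideal A) ↔ _
  rw [Submodule.mem_sInf]
  constructor
  · intro h I hI hS
    exact h _ ⟨I, hI, hS, rfl⟩
  · rintro h _ ⟨I, hI, hS, rfl⟩
    exact h I hI hS

lemma archSpan_isArchimedean (S : Set A) : (archSpan S).IsArchimedean := by
  rw [isArchimedean_iff]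
  intro a b h
  rw [mem_archSpan]
  intro I hI hS
  exact isArchimedean_iff.1 hI a b fun n => mem_archSpan.1 (h n) I hI hS

lemma subset_archSpan {S : Set A} {s : A} (hs : s ∈ S) : s ∈ archSpan S :=
  mem_archSpan.2 fun _ _ hS => hS s hs

end LIdeal

/-! ### The category of bounded archimedean `ℓ`-algebras -/

/-- Bounded archimedean `ℓ`-algebras. -/
structure BAL : Type (u + 1) where
  of ::
  carrier : Type u
  [commRing : CommRing carrier]
  [lattice : Lattice carrier]
  [algebra : Algebra ℝ carrier]
  [bddLAlgebra : BddLAlgebra carrier]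
  arch : IsArch carrier

attribute [instance] BAL.commRing BAL.lattice BAL.algebra BAL.bddLAlgebra

instance : CoeSort BAL.{u} (Type u) := ⟨BAL.carrier⟩

/-- Unital `ℓ`-algebra morphisms. -/
structure LHom (A B : Type u) [CommRing A] [Lattice A] [Algebra ℝ A]
    [CommRing B] [Lattice B] [Algebra ℝ B] extends A →ₐ[ℝ] B where
  map_sup' : ∀ a b : A, toFun (a ⊔ b) = toFun a ⊔ toFun b
  map_inf' : ∀ a b : A, toFun (a ⊓ b) = toFun a ⊓ toFun b

namespace LHom

variable {A B C : Type u} [CommRing A] [Lattice A] [Algebra ℝ A]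
  [CommRing B] [Lattice B] [Algebra ℝ B] [CommRing C] [Lattice C] [Algebra ℝ C]

instance : FunLike (LHom A B) A B where
  coe f := f.toFun
  coe_injective f g h := by
    cases f; cases g
    congr
    exact AlgHom.ext fun a => congrFun h a

instance : AlgHomClass (LHom A B) ℝ A B where
  map_mul f := f.map_mul'
  map_one f := f.map_one'
  map_add f := f.map_add'
  map_zero f := f.map_zero'
  commutes f := f.commutes'

instance : LatticeHomClass (LHom A B) A B where
  map_sup f := f.map_sup'
  map_inf f := f.map_inf'

@[ext]
lemma ext {f g : LHom A B} (h : ∀ a, f a = g a) : f = g := DFunLike.ext _ _ h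

/-- The identity. -/
def id (A : Type u) [CommRing A] [Lattice A] [Algebra ℝ A] : LHom A A where
  toAlgHom := AlgHom.id ℝ A
  map_sup' _ _ := rfl
  map_inf' _ _ := rfl

/-- Composition, in diagrammatic order. -/
def comp (f : LHom A B) (g : LHom B C) : LHom A C where
  toAlgHom := g.toAlgHom.comp f.toAlgHom
  map_sup' a b := by
    change g (f (a ⊔ b)) = g (f a) ⊔ g (f b)
    rw [map_sup, map_sup]
  map_inf' a b := by
    change g (f (a ⊓ b)) = g (f a) ⊓ g (f b)
    rw [map_inf, map_inf]

@[simp] lemma id_apply (a : A) : id A a = a := rfl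

@[simp] lemma comp_apply (f : LHom A B) (g : LHom B C) (a : A) : f.comp g a = g (f a) := rfl

lemma mono (f : LHom A B) {a b : A} (h : a ≤ b) : f a ≤ f b := OrderHomClass.mono f h

lemma map_abs' (f : LHom A B) (a : A) : f |a| = |f a| := by
  rw [abs, abs, map_sup, map_neg]

lemma map_alg (f : LHom A B) (r : ℝ) : f (algebraMap ℝ A r) = algebraMap ℝ B r :=
  AlgHomClass.commutes f r

end LHom

instance : Category BAL.{u} where
  Hom A B := LHom A B
  id A := LHom.id A
  comp f g := LHom.comp f g

namespace LIdeal

variable {A B : Type u} [CommRing A] [Lattice A] [Algebra ℝ A] [LAlgebra A]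
  [CommRing B] [Lattice B] [Algebra ℝ B] [LAlgebra B]

/-- The quotient map as an `ℓ`-algebra morphism. -/
def quoHom (I : LIdeal A) : LHom A I.Quot where
  toFun := I.quo
  map_one' := map_one _
  map_mul' := map_mul _
  map_zero' := map_zero _
  map_add' := map_add _
  commutes' _ := rfl
  map_sup' _ _ := rfl
  map_inf' _ _ := rfl

/-- An `ℓ`-algebra morphism that vanishes on `I` factors through `A / I`. -/
def liftHom (I : LIdeal A) (f : LHom A B) (h : ∀ a ∈ I, f a = 0) : LHom I.Quot B where
  toAlgHom := Ideal.Quotient.liftₐ I.toIdeal f.toAlgHom h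
  map_sup' := by rintro ⟨a⟩ ⟨b⟩; exact f.map_sup' a b
  map_inf' := by rintro ⟨a⟩ ⟨b⟩; exact f.map_inf' a b

@[simp] lemma liftHom_quo (I : LIdeal A) (f : LHom A B) (h : ∀ a ∈ I, f a = 0) (a : A) :
    I.liftHom f h (I.quo a) = f a := rfl

/-- The inverse image of an `ℓ`-ideal under an `ℓ`-algebra morphism. -/
def comap (f : LHom A B) (J : LIdeal B) : LIdeal A where
  toIdeal := J.toIdeal.comap f.toAlgHom
  solid a b hab hb := by
    refine J.solid (f a) (f b) ?_ hb
    rw [← LHom.map_abs', ← LHom.map_abs']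
    exact f.mono hab

lemma mem_comap {f : LHom A B} {J : LIdeal B} {a : A} : a ∈ comap f J ↔ f a ∈ J := Iff.rfl

lemma comap_isArchimedean (f : LHom A B) {J : LIdeal B} (hJ : J.IsArchimedean) :
    (comap f J).IsArchimedean := by
  rw [isArchimedean_iff] at *
  intro a b h
  have := hJ (f a) (f b) fun n => by
    have := h n
    rwa [mem_comap, map_sub, map_sup, map_nsmul] at this
  rwa [mem_comap, map_sup, map_zero]

end LIdeal

/-! ### The norm -/

section Norm

variable {A B : Type u} [CommRing A] [Lattice A] [Algebra ℝ A]
  [CommRing B] [Lattice B] [Algebra ℝ B]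

/-- The norm `‖a‖ = inf {r | |a| ≤ r · 1}`. -/
noncomputable def nrm (a : A) : ℝ := sInf {r : ℝ | |a| ≤ r • (1 : A)}

variable [BddLAlgebra A] [BddLAlgebra B]

lemma nrm_set_nonempty (a : A) : {r : ℝ | |a| ≤ r • (1 : A)}.Nonempty := by
  obtain ⟨n, -, hn⟩ := exists_abs_le a
  exact ⟨n, by rwa [Set.mem_ofPred_eq, ← Algebra.algebraMap_eq_smul_one]⟩

lemma nonneg_of_abs_le [Nontrivial A] {a : A} {r : ℝ} (h : |a| ≤ r • (1 : A)) : 0 ≤ r := by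
  by_contra hr
  rw [← Algebra.algebraMap_eq_smul_one] at h
  have h1 : (0 : A) ≤ algebraMap ℝ A r := (abs_nonneg a).trans h
  have h2 := (algebraMap_mono (A := A) (not_le.1 hr).le)
  rw [map_zero] at h2
  have h3 : algebraMap ℝ A r = 0 := le_antisymm h2 h1
  exact (not_le.1 hr).ne ((map_eq_zero (algebraMap ℝ A)).1 h3)

lemma nrm_nonneg (a : A) : 0 ≤ nrm a := by
  rcases subsingleton_or_nontrivial A with hA | hA
  · have : {r : ℝ | |a| ≤ r • (1 : A)} = Set.univ :=
      Set.eq_univ_of_forall fun r => (Subsingleton.elim _ _).le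
    rw [nrm, this, Real.sInf_univ]
  · exact Real.sInf_nonneg fun r hr => nonneg_of_abs_le hr

lemma nrm_le {a : A} {r : ℝ} (hr : 0 ≤ r) (h : |a| ≤ algebraMap ℝ A r) : nrm a ≤ r := by
  rcases subsingleton_or_nontrivial A with hA | hA
  · have : {r : ℝ | |a| ≤ r • (1 : A)} = Set.univ :=
      Set.eq_univ_of_forall fun r => (Subsingleton.elim _ _).le
    rwa [nrm, this, Real.sInf_univ]
  · refine csInf_le ⟨0, fun s hs => nonneg_of_abs_le hs⟩ ?_
    rwa [Set.mem_ofPred_eq, ← Algebra.algebraMap_eq_smul_one]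

lemma abs_le_of_nrm_lt {a : A} {r : ℝ} (h : nrm a < r) : |a| ≤ algebraMap ℝ A r := by
  obtain ⟨s, hs, hsr⟩ := exists_lt_of_csInf_lt (nrm_set_nonempty a) h
  rw [Set.mem_ofPred_eq, ← Algebra.algebraMap_eq_smul_one] at hs
  exact hs.trans (algebraMap_mono hsr.le)

lemma le_algebraMap_of_forall (hA : IsArch A) {a : A} {r : ℝ}
    (h : ∀ ε : ℝ, 0 < ε → a ≤ algebraMap ℝ A (r + ε)) : a ≤ algebraMap ℝ A r := by
  rw [← sub_nonpos]
  refine hA _ 1 fun n => ?_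
  have h1 := h (1 / (n + 1)) (by positivity)
  rw [map_add, ← sub_le_iff_le_add'] at h1
  have h2 := nsmul_le_nsmul_right h1 n
  refine h2.trans ?_
  rw [← map_nsmul, ← map_one (algebraMap ℝ A)]
  refine algebraMap_mono ?_
  rw [nsmul_eq_mul, mul_one_div, div_le_one (by positivity)]
  linarith

lemma abs_le_nrm (hA : IsArch A) (a : A) : |a| ≤ algebraMap ℝ A (nrm a) :=
  le_algebraMap_of_forall hA fun _ hε => abs_le_of_nrm_lt (by linarith)

lemma nrm_map_le (hA : IsArch A) (f : LHom A B) (a : A) : nrm (f a) ≤ nrm a := by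
  refine nrm_le (nrm_nonneg a) ?_
  rw [← f.map_abs', ← f.map_alg]
  exact f.mono (abs_le_nrm hA a)

end Norm

end Bal

namespace Bal

/-! ### Free bounded archimedean `ℓ`-algebras over weighted sets -/

/-- `ℓ`-algebra terms over a set `X` of generators. -/
inductive Term (X : Type u) : Type u
  | var : X → Term X
  | const : ℝ → Term X
  | add : Term X → Term X → Term X
  | mul : Term X → Term X → Term X
  | sup : Term X → Term X → Term X
  | inf : Term X → Term X → Term X

/-- Evaluation of a term under an assignment of the generators. -/
noncomputable def Term.eval {X : Type u} {B : Type u} [CommRing B] [Lattice B] [Algebra ℝ B]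
    (g : X → B) : Term X → B
  | .var x => g x
  | .const r => algebraMap ℝ B r
  | .add s t => s.eval g + t.eval g
  | .mul s t => s.eval g * t.eval g
  | .sup s t => s.eval g ⊔ t.eval g
  | .inf s t => s.eval g ⊓ t.eval g

/-- Weighted set morphisms from `(X, w)` to `(B, ‖·‖)`. -/
def IsWeighted {X : Type u} (w : X → ℝ≥0) {B : Type u} [CommRing B] [Lattice B] [Algebra ℝ B]
    (g : X → B) : Prop := ∀ x, nrm (g x) ≤ w x

/-- Two terms are identified if they have the same value under every weighted set morphism into a
bounded archimedean `ℓ`-algebra. -/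
def Term.setoid {X : Type u} (w : X → ℝ≥0) : Setoid (Term X) where
  r s t := ∀ (B : BAL.{u}) (g : X → B), IsWeighted w g → s.eval g = t.eval g
  iseqv := ⟨fun _ _ _ _ => rfl, fun h B g hg => (h B g hg).symm,
    fun h h' B g hg => (h B g hg).trans (h' B g hg)⟩

/-- The underlying type of the free bounded archimedean `ℓ`-algebra over the weighted set
`(X, w)`; its universal property is `Free.lift` with `Free.lift_ι` and `Free.hom_ext`. -/
def Free {X : Type u} (w : X → ℝ≥0) : Type u := Quotient (Term.setoid w)

namespace Free

variable {X : Type u} {w : X → ℝ≥0}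

/-- The class of a term. -/
def cls (t : Term X) : Free w := Quotient.mk (Term.setoid w) t

/-- The value of an element of the free algebra under a weighted set morphism. -/
noncomputable def ev {B : BAL.{u}} (g : X → B) (hg : IsWeighted w g) : Free w → B :=
  Quotient.lift (Term.eval g) fun _ _ h => h B g hg

lemma ev_cls {B : BAL.{u}} (g : X → B) (hg : IsWeighted w g) (t : Term X) :
    ev g hg (cls t) = t.eval g := rfl

lemma ext_ev {x y : Free w}
    (h : ∀ (B : BAL.{u}) (g : X → B) (hg : IsWeighted w g), ev g hg x = ev g hg y) : x = y := by
  induction x using Quotient.inductionOn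
  induction y using Quotient.inductionOn
  exact Quotient.sound h

noncomputable instance : Add (Free w) where
  add := Quotient.map₂ .add fun _ _ h _ _ h' B g hg =>
    congrArg₂ (· + ·) (h B g hg) (h' B g hg)

noncomputable instance : Mul (Free w) where
  mul := Quotient.map₂ .mul fun _ _ h _ _ h' B g hg =>
    congrArg₂ (· * ·) (h B g hg) (h' B g hg)

/-- Join in the free algebra. -/
noncomputable abbrev freeMax : Max (Free w) where
  max := Quotient.map₂ .sup fun _ _ h _ _ h' B g hg =>
    congrArg₂ (· ⊔ ·) (h B g hg) (h' B g hg)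

/-- Meet in the free algebra. -/
noncomputable abbrev freeMin : Min (Free w) where
  min := Quotient.map₂ .inf fun _ _ h _ _ h' B g hg =>
    congrArg₂ (· ⊓ ·) (h B g hg) (h' B g hg)

/-- The constant `r`. -/
def const (r : ℝ) : Free w := cls (.const r)

instance : Zero (Free w) := ⟨const 0⟩
instance : One (Free w) := ⟨const 1⟩
noncomputable instance : Neg (Free w) := ⟨fun x => const (-1) * x⟩

section

variable {B : BAL.{u}} (g : X → B) (hg : IsWeighted w g)

lemma ev_const (r : ℝ) : ev g hg (const r) = algebraMap ℝ B r := rfl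

lemma ev_zero : ev g hg 0 = 0 := map_zero (algebraMap ℝ B)

lemma ev_one : ev g hg 1 = 1 := map_one (algebraMap ℝ B)

lemma ev_add (x y : Free w) : ev g hg (x + y) = ev g hg x + ev g hg y := by
  induction x using Quotient.inductionOn
  induction y using Quotient.inductionOn
  rfl

lemma ev_mul (x y : Free w) : ev g hg (x * y) = ev g hg x * ev g hg y := by
  induction x using Quotient.inductionOn
  induction y using Quotient.inductionOn
  rfl

lemma ev_neg (x : Free w) : ev g hg (-x) = -ev g hg x := by
  change ev g hg (const (-1) * x) = _
  rw [ev_mul, ev_const]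
  simp

end

noncomputable instance : CommRing (Free w) where
  add_assoc x y z := ext_ev fun B g hg => by simp only [ev_add]; ring
  zero_add x := ext_ev fun B g hg => by simp only [ev_add, ev_zero]; ring
  add_zero x := ext_ev fun B g hg => by simp only [ev_add, ev_zero]; ring
  add_comm x y := ext_ev fun B g hg => by simp only [ev_add]; ring
  left_distrib x y z := ext_ev fun B g hg => by simp only [ev_add, ev_mul]; ring
  right_distrib x y z := ext_ev fun B g hg => by simp only [ev_add, ev_mul]; ring
  zero_mul x := ext_ev fun B g hg => by simp only [ev_mul, ev_zero]; ring
  mul_zero x := ext_ev fun B g hg => by simp only [ev_mul, ev_zero]; ring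
  mul_assoc x y z := ext_ev fun B g hg => by simp only [ev_mul]; ring
  one_mul x := ext_ev fun B g hg => by simp only [ev_mul, ev_one]; ring
  mul_one x := ext_ev fun B g hg => by simp only [ev_mul, ev_one]; ring
  mul_comm x y := ext_ev fun B g hg => by simp only [ev_mul]; ring
  neg_add_cancel x := ext_ev fun B g hg => by simp only [ev_add, ev_neg, ev_zero]; ring
  nsmul := nsmulRec
  zsmul := zsmulRec

noncomputable instance : Lattice (Free w) :=
  @Lattice.mk' _ freeMax freeMin
    (by rintro ⟨a⟩ ⟨b⟩; exact Quotient.sound fun B g hg => sup_comm _ _)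
    (by rintro ⟨a⟩ ⟨b⟩ ⟨c⟩; exact Quotient.sound fun B g hg => sup_assoc _ _ _)
    (by rintro ⟨a⟩ ⟨b⟩; exact Quotient.sound fun B g hg => inf_comm _ _)
    (by rintro ⟨a⟩ ⟨b⟩ ⟨c⟩; exact Quotient.sound fun B g hg => inf_assoc _ _ _)
    (by rintro ⟨a⟩ ⟨b⟩; exact Quotient.sound fun B g hg => sup_inf_self)
    (by rintro ⟨a⟩ ⟨b⟩; exact Quotient.sound fun B g hg => inf_sup_self)

/-- The constants form a copy of `ℝ`. -/
noncomputable def constHom : ℝ →+* Free w where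
  toFun := const
  map_one' := rfl
  map_zero' := rfl
  map_mul' r s := ext_ev fun B g hg => by simp only [ev_mul, ev_const, map_mul]
  map_add' r s := ext_ev fun B g hg => by simp only [ev_add, ev_const, map_add]

noncomputable instance : Algebra ℝ (Free w) := constHom.toAlgebra

lemma smul_eq (r : ℝ) (x : Free w) : r • x = const r * x := rfl

section

variable {B : BAL.{u}} (g : X → B) (hg : IsWeighted w g)

lemma ev_sup (x y : Free w) : ev g hg (x ⊔ y) = ev g hg x ⊔ ev g hg y := by
  induction x using Quotient.inductionOn
  induction y using Quotient.inductionOn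
  rfl

lemma ev_inf (x y : Free w) : ev g hg (x ⊓ y) = ev g hg x ⊓ ev g hg y := by
  induction x using Quotient.inductionOn
  induction y using Quotient.inductionOn
  rfl

/-- The evaluation at `g` as an `ℓ`-algebra morphism. -/
noncomputable def evHom : LHom (Free w) B where
  toFun := ev g hg
  map_one' := ev_one g hg
  map_mul' := ev_mul g hg
  map_zero' := ev_zero g hg
  map_add' := ev_add g hg
  commutes' _ := rfl
  map_sup' := ev_sup g hg
  map_inf' := ev_inf g hg

end

lemma le_iff {x y : Free w} : x ≤ y ↔
    ∀ (B : BAL.{u}) (g : X → B) (hg : IsWeighted w g), evHom g hg x ≤ evHom g hg y := by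
  constructor
  · intro h B g hg
    exact LHom.mono _ h
  · intro h
    rw [← sup_eq_right]
    refine ext_ev fun B g hg => ?_
    rw [ev_sup]
    exact sup_eq_right.2 (h B g hg)

instance : LAlgebra (Free w) where
  add_le_add_right' x y z h := le_iff.2 fun B g hg => by
    rw [map_add, map_add]
    exact LAlgebra.add_le_add_right' _ _ _ (le_iff.1 h B g hg)
  mul_nonneg' x y hx hy := le_iff.2 fun B g hg => by
    rw [map_mul, map_zero]
    exact mul_nonneg (by simpa using le_iff.1 hx B g hg) (by simpa using le_iff.1 hy B g hg)
  smul_nonneg' r x hr hx := le_iff.2 fun B g hg => by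
    rw [map_smul, map_zero]
    exact LAlgebra.smul_nonneg' _ _ hr (by simpa using le_iff.1 hx B g hg)

lemma exists_bound (w : X → ℝ≥0) (t : Term X) : ∃ n : ℝ, 0 ≤ n ∧ ∀ (B : BAL.{u}) (g : X → B),
    IsWeighted w g → |t.eval g| ≤ algebraMap ℝ B n := by
  induction t with
  | var x =>
    refine ⟨w x, (w x).2, fun B g hg => ?_⟩
    exact (abs_le_nrm B.arch _).trans (algebraMap_mono (hg x))
  | const r =>
    refine ⟨|r|, abs_nonneg r, fun B g hg => ?_⟩
    refine abs_le'.2 ⟨algebraMap_mono (le_abs_self r), ?_⟩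
    rw [Term.eval, ← map_neg]
    exact algebraMap_mono (neg_le_abs r)
  | add s t hs ht =>
    obtain ⟨m, hm0, hm⟩ := hs
    obtain ⟨n, hn0, hn⟩ := ht
    refine ⟨m + n, by positivity, fun B g hg => ?_⟩
    rw [Term.eval, map_add]
    exact (abs_add_le _ _).trans (add_le_add (hm B g hg) (hn B g hg))
  | mul s t hs ht =>
    obtain ⟨m, hm0, hm⟩ := hs
    obtain ⟨n, hn0, hn⟩ := ht
    refine ⟨m * n, by positivity, fun B g hg => ?_⟩
    rw [Term.eval, map_mul]
    exact (abs_mul_le_of_abs_le (hm B g hg) _).trans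
      (mul_le_mul_of_nonneg_left (hn B g hg) (algebraMap_nonneg' hm0))
  | sup s t hs ht =>
    obtain ⟨m, hm0, hm⟩ := hs
    obtain ⟨n, hn0, hn⟩ := ht
    refine ⟨m + n, by positivity, fun B g hg => ?_⟩
    have h1 := (hm B g hg).trans (algebraMap_mono (A := B) (show m ≤ m + n by linarith))
    have h2 := (hn B g hg).trans (algebraMap_mono (A := B) (show n ≤ m + n by linarith))
    rw [abs_le'] at *
    exact ⟨sup_le h1.1 h2.1, (neg_le_neg le_sup_left).trans h1.2⟩
  | inf s t hs ht =>
    obtain ⟨m, hm0, hm⟩ := hs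
    obtain ⟨n, hn0, hn⟩ := ht
    refine ⟨m + n, by positivity, fun B g hg => ?_⟩
    have h1 := (hm B g hg).trans (algebraMap_mono (A := B) (show m ≤ m + n by linarith))
    have h2 := (hn B g hg).trans (algebraMap_mono (A := B) (show n ≤ m + n by linarith))
    rw [abs_le'] at *
    exact ⟨inf_le_left.trans h1.1, neg_le.1 (le_inf (neg_le.1 h1.2) (neg_le.1 h2.2))⟩

instance : BddLAlgebra (Free w) where
  bounded' x := by
    obtain ⟨t, rfl⟩ := Quotient.exists_rep x
    obtain ⟨r, -, hr⟩ := exists_bound w t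
    obtain ⟨n, hn⟩ := exists_nat_ge r
    refine ⟨n, le_iff.2 fun B g hg => ?_⟩
    rw [map_nsmul, map_one, nsmul_one, ← map_natCast (algebraMap ℝ B) n]
    exact (le_abs_self _).trans ((hr B g hg).trans (algebraMap_mono hn))

lemma isArch : IsArch (Free w) := fun x y h => le_iff.2 fun B g hg => by
  rw [map_zero]
  exact B.arch _ (evHom g hg y) fun n => by
    rw [← map_nsmul]
    exact le_iff.1 (h n) B g hg

/-- The insertion of generators. -/
def ι (x : X) : Free w := cls (.var x)

lemma ι_isWeighted : IsWeighted w (ι : X → Free w) := fun x => by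
  have key : ∀ (B : BAL.{u}) (g : X → B), IsWeighted w g → |g x| ≤ algebraMap ℝ B (w x) :=
    fun B g hg => (abs_le_nrm B.arch _).trans (algebraMap_mono (hg x))
  refine nrm_le (w x).2 (le_iff.2 fun B g hg => ?_)
  rw [LHom.map_abs', LHom.map_alg]
  exact key B g hg

/-- The extension of a weighted set morphism to the free algebra. -/
noncomputable def lift {B : BAL.{u}} (g : X → B) (hg : IsWeighted w g) : LHom (Free w) B :=
  evHom g hg

@[simp] lemma lift_ι {B : BAL.{u}} (g : X → B) (hg : IsWeighted w g) (x : X) :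
    lift g hg (ι x) = g x := rfl

lemma hom_ext {B : Type u} [CommRing B] [Lattice B] [Algebra ℝ B] {f f' : LHom (Free w) B}
    (h : ∀ x, f (ι x) = f' (ι x)) : f = f' := by
  ext z
  obtain ⟨t, rfl⟩ := Quotient.exists_rep z
  change f (cls t) = f' (cls t)
  induction t with
  | var x => exact h x
  | const r => exact (f.map_alg r).trans (f'.map_alg r).symm
  | add s t hs ht =>
    change f (cls s + cls t) = f' (cls s + cls t)
    rw [map_add, map_add, hs, ht]
  | mul s t hs ht =>
    change f (cls s * cls t) = f' (cls s * cls t)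
    rw [map_mul, map_mul, hs, ht]
  | sup s t hs ht =>
    change f (cls s ⊔ cls t) = f' (cls s ⊔ cls t)
    rw [map_sup, map_sup, hs, ht]
  | inf s t hs ht =>
    change f (cls s ⊓ cls t) = f' (cls s ⊓ cls t)
    rw [map_inf, map_inf, hs, ht]

end Free

/-! ### The endofunctor `H` -/

section H

variable (A : BAL.{u})

/-- The weight function `w_A(a) = max {‖a‖, 1}`. -/
noncomputable def wt (a : A) : ℝ≥0 := ⟨max (nrm a) 1, le_max_of_le_right zero_le_one⟩

/-- The free algebra `F(A)` over `(A, w_A)`. -/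
abbrev F : Type u := Free (wt A)

/-- The map `f_A : A → F(A)`. -/
noncomputable def fMap (a : A) : F A := Free.ι a

/-- The defining relations of `H(A)`. -/
inductive Rel : F A → Prop
  | inf (a b : A) : Rel (fMap A (a ⊓ b) - (fMap A a ⊓ fMap A b))
  | const (r : ℝ) : Rel (fMap A (algebraMap ℝ A r) - algebraMap ℝ (F A) r
      - (1 - algebraMap ℝ (F A) r) * fMap A 0)
  | pos (a : A) : Rel (fMap A (a ⊔ 0) - (fMap A a ⊔ 0))
  | add (a : A) (r : ℝ) : Rel (fMap A (a + algebraMap ℝ A r) - fMap A a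
      - fMap A (algebraMap ℝ A r) + fMap A 0)
  | mul (r : ℝ) (a : A) (hr : 0 ≤ r) : Rel (fMap A (r • a) - fMap A (algebraMap ℝ A r) * fMap A a)

/-- The archimedean `ℓ`-ideal `I_A` of `F(A)`. -/
noncomputable def relIdeal : LIdeal (F A) := LIdeal.archSpan {z | Rel A z}

/-- `H(A) = F(A) / I_A`. -/
noncomputable def HObj : BAL.{u} where
  carrier := (relIdeal A).Quot
  commRing := inferInstance
  lattice := inferInstance
  algebra := inferInstance
  bddLAlgebra := inferInstance
  arch := LIdeal.archSpan_isArchimedean _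

/-- The map `h_A : A → H(A)`. -/
noncomputable def box (a : A) : HObj A := (relIdeal A).quo (fMap A a)

variable {A} {B C : BAL.{u}}

lemma HObj.hom_ext {D : Type u} [CommRing D] [Lattice D] [Algebra ℝ D] {f g : LHom (HObj A) D}
    (h : ∀ a, f (box A a) = g (box A a)) : f = g := by
  have : (relIdeal A).quoHom.comp f = (relIdeal A).quoHom.comp g := Free.hom_ext h
  ext z
  obtain ⟨y, rfl⟩ := (relIdeal A).quo_surjective z
  exact DFunLike.congr_fun this y

/-- The morphism `F(A) → F(B)` induced by `α : A → B`. -/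
noncomputable def FMap (α : A ⟶ B) : LHom (F A) (F B) :=
  Free.lift (B := BAL.of (F B) Free.isArch) (fun a => fMap B (α.toFun a)) fun a =>
    (Free.ι_isWeighted (w := wt B) _).trans (max_le_max_right 1 (nrm_map_le A.arch α a))

lemma FMap_fMap (α : LHom A B) (a : A) : FMap (A := A) (B := B) α (fMap A a) = fMap B (α a) := rfl

lemma FMap_rel (α : A ⟶ B) {z : F A} (hz : z ∈ relIdeal A) : FMap α z ∈ relIdeal B := by
  refine LIdeal.mem_archSpan.1 hz (LIdeal.comap (FMap α) (relIdeal B))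
    (LIdeal.comap_isArchimedean _ (LIdeal.archSpan_isArchimedean _)) ?_
  intro s hs
  refine LIdeal.subset_archSpan ?_
  change Rel B (FMap α s)
  change LHom A B at α
  induction hs with
  | inf a b =>
    simp only [map_sub, map_inf, FMap_fMap]
    exact Rel.inf _ _
  | const r =>
    simp only [map_sub, map_mul, map_one, map_zero, FMap_fMap, LHom.map_alg]
    exact Rel.const r
  | pos a =>
    simp only [map_sub, map_sup, map_zero, FMap_fMap]
    exact Rel.pos _
  | add a r =>
    simp only [map_sub, map_add, map_zero, FMap_fMap, LHom.map_alg]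
    exact Rel.add _ _
  | mul r a hr =>
    simp only [map_sub, map_mul, map_smul, FMap_fMap, LHom.map_alg]
    exact Rel.mul _ _ hr

/-- The morphism `H(α)`. -/
noncomputable def HMap (α : A ⟶ B) : HObj A ⟶ HObj B :=
  (relIdeal A).liftHom ((FMap α).comp (relIdeal B).quoHom) fun _ hz =>
    LIdeal.quo_eq_zero.2 (FMap_rel α hz)

lemma HMap_box (α : LHom A B) (a : A) :
    DFunLike.coe (F := LHom (HObj A) (HObj B)) (HMap α) (box A a) = box B (α a) := rfl

/-- The endofunctor `H`; `H(α)` is the morphism with `H(α) ∘ h_A = h_B ∘ α`. -/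
noncomputable def H : BAL.{u} ⥤ BAL.{u} where
  obj := HObj
  map := HMap
  map_id _ := HObj.hom_ext fun _ => rfl
  map_comp _ _ := HObj.hom_ext fun _ => rfl

end H

end Bal

namespace Bal

/-! ### The Yosida space -/

section Yosida

variable {A : Type u} [CommRing A] [Lattice A]

/-- Maximal `ℓ`-ideals: proper `ℓ`-ideals that are maximal among the proper `ℓ`-ideals. -/
def LIdeal.IsMaximal (M : LIdeal A) : Prop :=
  1 ∉ M ∧ ∀ J : LIdeal A, (∀ a ∈ M, a ∈ J) → 1 ∉ J → J = M

variable (A) in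
/-- The set of maximal `ℓ`-ideals of `A`. -/
@[ext]
structure Yosida : Type u where
  ideal : LIdeal A
  isMaximal : ideal.IsMaximal

/-- The set `Z_ℓ(I)` of all maximal `ℓ`-ideals containing `I`. -/
def zeroSet (I : LIdeal A) : Set (Yosida A) := {M | ∀ a ∈ I, a ∈ M.1}

variable [Algebra ℝ A] [BddLAlgebra A]

lemma LIdeal.mem_of_one_mem {I : LIdeal A} (h : 1 ∈ I) (a : A) : a ∈ I := by
  have := I.toIdeal.mul_mem_left a h
  rwa [mul_one] at this

lemma LIdeal.one_notMem_of_algebraMap {I : LIdeal A} (h : 1 ∉ I) {r : ℝ} (hr : r ≠ 0) :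
    algebraMap ℝ A r ∉ I := fun h' => h <| by
  have := I.toIdeal.mul_mem_left (algebraMap ℝ A r⁻¹) h'
  rwa [← map_mul, inv_mul_cancel₀ hr, map_one] at this

/-- A solid set closed under sums of absolute values and natural multiples, as an `ℓ`-ideal. -/
def LIdeal.ofSolid (S : Set A) (h0 : 0 ∈ S) (hadd : ∀ a b, a ∈ S → b ∈ S → |a| + |b| ∈ S)
    (hmul : ∀ a (n : ℕ), 1 ≤ n → a ∈ S → algebraMap ℝ A n * |a| ∈ S)
    (hsol : ∀ a b : A, |a| ≤ |b| → b ∈ S → a ∈ S) : LIdeal A where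
  toIdeal :=
    { carrier := S
      zero_mem' := h0
      add_mem' := fun {a b} ha hb => by
        refine hsol _ _ ?_ (hadd a b ha hb)
        exact (abs_add_le a b).trans (le_abs_self _)
      smul_mem' := fun c a ha => by
        obtain ⟨n, hn, hc⟩ := exists_abs_le c
        exact hsol _ _ ((abs_mul_le_of_abs_le hc a).trans (le_abs_self _)) (hmul a n hn ha) }
  solid := hsol

lemma nsmul_inf_le {n : ℕ} {x y : A} (hy : 0 ≤ y) (hn : 1 ≤ n) :
    (algebraMap ℝ A n * x) ⊓ y ≤ algebraMap ℝ A n * (x ⊓ y) := by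
  have hn0 : (0 : ℝ) < n := by exact_mod_cast hn
  have hinv : ∀ z : A, algebraMap ℝ A n * (algebraMap ℝ A (n : ℝ)⁻¹ * z) = z := fun z => by
    rw [← mul_assoc, ← map_mul, mul_inv_cancel₀ hn0.ne', map_one, one_mul]
  have hinv' : ∀ z : A, algebraMap ℝ A (n : ℝ)⁻¹ * (algebraMap ℝ A n * z) = z := fun z => by
    rw [← mul_assoc, ← map_mul, inv_mul_cancel₀ hn0.ne', map_one, one_mul]
  have hp := algebraMap_nonneg' (A := A) (inv_nonneg.2 hn0.le)
  rw [← hinv ((algebraMap ℝ A n * x) ⊓ y)]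
  refine mul_le_mul_of_nonneg_left (le_inf ?_ ?_) (algebraMap_nonneg' hn0.le)
  · refine (mul_le_mul_of_nonneg_left inf_le_left hp).trans ?_
    rw [hinv']
  · refine (mul_le_mul_of_nonneg_left inf_le_right hp).trans ?_
    have : algebraMap ℝ A (n : ℝ)⁻¹ ≤ 1 := by
      rw [← map_one (algebraMap ℝ A)]
      refine algebraMap_mono (inv_le_one_of_one_le₀ (by exact_mod_cast hn))
    simpa using mul_le_mul_of_nonneg_right this hy

lemma add_inf_le {x y z : A} (hx : 0 ≤ x) (hy : 0 ≤ y) (hz : 0 ≤ z) :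
    (x + y) ⊓ z ≤ x ⊓ z + y ⊓ z := by
  have h1 : (x + y) ⊓ z ≤ x + y ⊓ z := by
    rw [add_inf]
    exact le_inf inf_le_left (inf_le_right.trans (le_add_of_nonneg_left hx))
  have h2 : (x + y) ⊓ z ≤ z + y ⊓ z :=
    inf_le_right.trans (le_add_of_nonneg_right (le_inf hy hz))
  rw [inf_add]
  exact le_inf h1 h2

/-- Maximal `ℓ`-ideals are prime. -/
lemma LIdeal.IsMaximal.mem_or_mem {M : LIdeal A} (hM : M.IsMaximal) {a b : A}
    (ha : 0 ≤ a) (hb : 0 ≤ b) (hab : a ⊓ b ∈ M) : a ∈ M ∨ b ∈ M := by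
  by_contra! hne
  obtain ⟨haM, hbM⟩ := hne
  let J : LIdeal A := LIdeal.ofSolid {x | |x| ⊓ a ∈ M}
    (by
      rw [Set.mem_ofPred_eq, abs_zero, inf_eq_left.2 ha]
      exact M.toIdeal.zero_mem)
    (by
      intro x y hx hy
      rw [Set.mem_ofPred_eq] at *
      refine mem_of_nonneg_le (le_inf (abs_nonneg _) ha) ?_ (M.toIdeal.add_mem hx hy)
      rw [abs_of_nonneg (add_nonneg (abs_nonneg x) (abs_nonneg y))]
      exact add_inf_le (abs_nonneg x) (abs_nonneg y) ha)
    (by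
      intro x n hn hx
      rw [Set.mem_ofPred_eq] at *
      refine mem_of_nonneg_le (le_inf (abs_nonneg _) ha) ?_ (M.toIdeal.mul_mem_left
        (algebraMap ℝ A n) hx)
      rw [abs_of_nonneg (mul_nonneg (algebraMap_nonneg' (Nat.cast_nonneg n)) (abs_nonneg x))]
      exact nsmul_inf_le ha hn)
    (by
      intro x y hxy hy
      rw [Set.mem_ofPred_eq] at *
      exact mem_of_nonneg_le (le_inf (abs_nonneg _) ha) (inf_le_inf_right a hxy) hy)
  have hJ : ∀ x, x ∈ J ↔ |x| ⊓ a ∈ M := fun x => Iff.rfl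
  have h1 : (1 : A) ∉ J := by
    rw [hJ]
    intro h
    obtain ⟨n, hn, han⟩ := exists_abs_le a
    refine haM (mem_of_nonneg_le ha ?_ (M.toIdeal.mul_mem_left (algebraMap ℝ A n) h))
    refine le_trans ?_ (nsmul_inf_le ha hn)
    refine le_inf ?_ le_rfl
    rw [abs_of_nonneg zero_le_one', mul_one]
    exact (le_abs_self a).trans han
  have hMJ : J = M := hM.2 J (fun x hx => (hJ x).2
    (mem_of_nonneg_le (le_inf (abs_nonneg _) ha) inf_le_left (abs_mem hx))) h1
  refine hbM ?_
  rw [← hMJ, hJ, abs_of_nonneg hb, inf_comm]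
  exact hab

lemma LIdeal.IsMaximal.mem_of_infinitesimal {M : LIdeal A} (hM : M.IsMaximal) {x : A}
    (hx : ∀ ε : ℝ, 0 < ε → (|x| - algebraMap ℝ A ε) ⊔ 0 ∈ M) : x ∈ M := by
  let J : LIdeal A := LIdeal.ofSolid {x | ∀ ε : ℝ, 0 < ε → (|x| - algebraMap ℝ A ε) ⊔ 0 ∈ M}
    (by
      intro ε hε
      rw [abs_zero, zero_sub, sup_eq_right.2 (neg_nonpos.2 (algebraMap_nonneg' hε.le))]
      exact M.toIdeal.zero_mem)
    (by
      intro x y hx hy ε hε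
      refine mem_of_nonneg_le le_sup_right ?_
        (M.toIdeal.add_mem (hx (ε / 2) (by positivity)) (hy (ε / 2) (by positivity)))
      rw [abs_of_nonneg (add_nonneg (abs_nonneg x) (abs_nonneg y))]
      refine sup_le ?_ (add_nonneg le_sup_right le_sup_right)
      refine le_trans (le_of_eq ?_) (add_le_add le_sup_left le_sup_left)
      nth_rw 1 [← add_halves ε]
      rw [map_add]
      ring)
    (by
      intro x n hn hx ε hε
      have hn0 : (0 : ℝ) < n := by exact_mod_cast hn
      refine mem_of_nonneg_le le_sup_right ?_
        (M.toIdeal.mul_mem_left (algebraMap ℝ A n) (hx (ε / n) (by positivity)))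
      rw [abs_of_nonneg (mul_nonneg (algebraMap_nonneg' (Nat.cast_nonneg n)) (abs_nonneg x))]
      have hnn := algebraMap_nonneg' (A := A) hn0.le
      refine sup_le ?_ (mul_nonneg hnn le_sup_right)
      refine le_trans (le_of_eq ?_) (mul_le_mul_of_nonneg_left le_sup_left hnn)
      rw [mul_sub, ← map_mul, mul_div_cancel₀ _ hn0.ne'])
    (by
      intro x y hxy hy ε hε
      exact mem_of_nonneg_le le_sup_right (sup_le_sup_right (sub_le_sub_right hxy _) 0) (hy ε hε))
  have hJ : ∀ x, x ∈ J ↔ ∀ ε : ℝ, 0 < ε → (|x| - algebraMap ℝ A ε) ⊔ 0 ∈ M := fun x => Iff.rfl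
  have h1 : (1 : A) ∉ J := by
    rw [hJ]
    intro h
    refine LIdeal.one_notMem_of_algebraMap hM.1 (r := 1 / 2) (by norm_num) ?_
    have := h (1 / 2) (by norm_num)
    rw [abs_of_nonneg zero_le_one', ← map_one (algebraMap ℝ A), ← map_sub,
      sup_eq_left.2 (algebraMap_nonneg' (by norm_num))] at this
    norm_num at this ⊢
    exact this
  have hMJ : J = M := hM.2 J (fun x hx => (hJ x).2 fun ε hε =>
    mem_of_nonneg_le le_sup_right (sup_le (sub_le_self _ (algebraMap_nonneg' hε.le))
      (abs_nonneg x)) (abs_mem hx)) h1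
  rw [← hMJ]
  exact hx

/-- `A / M` is `ℝ`: every element is congruent to a real number modulo a maximal `ℓ`-ideal. -/
lemma LIdeal.IsMaximal.exists_sub_mem {M : LIdeal A} (hM : M.IsMaximal) (a : A) :
    ∃ r : ℝ, a - algebraMap ℝ A r ∈ M := by
  let S : Set ℝ := {s | (a - algebraMap ℝ A s) ⊔ 0 ∈ M}
  obtain ⟨n, hn, han⟩ := exists_abs_le a
  have hne : S.Nonempty := ⟨n, by
    have : a - algebraMap ℝ A n ≤ 0 := sub_nonpos.2 ((le_abs_self a).trans han)
    rw [Set.mem_ofPred_eq, sup_eq_right.2 this]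
    exact M.toIdeal.zero_mem⟩
  have hbdd : BddBelow S := ⟨-n, fun s hs => by
    by_contra hlt
    rw [not_le] at hlt
    refine LIdeal.one_notMem_of_algebraMap hM.1 (r := -n - s) (by linarith) ?_
    refine mem_of_nonneg_le (algebraMap_nonneg' (by linarith)) ?_ hs
    refine le_trans ?_ le_sup_left
    rw [map_sub]
    refine sub_le_sub_right ?_ _
    rw [map_neg, neg_le]
    exact (neg_le_abs a).trans han⟩
  have hup : ∀ s, sInf S < s → (a - algebraMap ℝ A s) ⊔ 0 ∈ M := by
    intro s hs
    obtain ⟨t, ht, hts⟩ := exists_lt_of_csInf_lt hne hs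
    exact mem_of_nonneg_le le_sup_right
      (sup_le_sup_right (sub_le_sub_left (algebraMap_mono hts.le) a) 0) ht
  have hdown : ∀ s, s < sInf S → (algebraMap ℝ A s - a) ⊔ 0 ∈ M := by
    intro s hs
    refine (hM.mem_or_mem le_sup_right le_sup_right ?_).resolve_left
      (fun h : (a - algebraMap ℝ A s) ⊔ 0 ∈ M => hs.not_ge (csInf_le hbdd h))
    have : ((a - algebraMap ℝ A s) ⊔ 0) ⊓ ((algebraMap ℝ A s - a) ⊔ 0) = 0 := by
      have := posPart_inf_negPart_eq_zero (a - algebraMap ℝ A s)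
      rwa [posPart_def, negPart_def, neg_sub] at this
    rw [this]
    exact M.toIdeal.zero_mem
  refine ⟨sInf S, hM.mem_of_infinitesimal fun ε hε => ?_⟩
  refine mem_of_nonneg_le le_sup_right ?_
    (M.toIdeal.add_mem (hup (sInf S + ε) (by linarith)) (hdown (sInf S - ε) (by linarith)))
  refine sup_le ?_ (add_nonneg le_sup_right le_sup_right)
  rw [sub_le_iff_le_add]
  refine abs_le'.2 ⟨?_, ?_⟩
  · rw [← sub_le_iff_le_add, sub_sub, ← map_add]
    exact le_sup_left.trans (le_add_of_nonneg_right le_sup_right)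
  · rw [← sub_le_iff_le_add, neg_sub, sub_sub, add_comm a, ← sub_sub, ← map_sub]
    exact le_sup_left.trans (le_add_of_nonneg_left le_sup_right)

/-- Every proper `ℓ`-ideal is contained in a maximal one. -/
lemma LIdeal.exists_le_maximal (I : LIdeal A) (hI : 1 ∉ I) :
    ∃ M : Yosida A, ∀ a ∈ I, a ∈ M.1 := by
  let S : Set (Ideal A) := {J | 1 ∉ J ∧ ∀ a b : A, |a| ≤ |b| → b ∈ J → a ∈ J}
  obtain ⟨M, hIM, hM⟩ := zorn_le_nonempty₀ S (by
    intro c hc hchain J hJ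
    have hmem : ∀ x, x ∈ sSup c ↔ ∃ K ∈ c, x ∈ K := fun x =>
      Submodule.mem_sSup_of_directed ⟨J, hJ⟩ hchain.directedOn
    refine ⟨sSup c, ⟨?_, ?_⟩, fun K hK => le_sSup hK⟩
    · rw [hmem]
      rintro ⟨K, hK, h1⟩
      exact (hc hK).1 h1
    · intro a b hab hb
      rw [hmem] at *
      obtain ⟨K, hK, hbK⟩ := hb
      exact ⟨K, hK, (hc hK).2 a b hab hbK⟩) I.toIdeal ⟨hI, I.solid⟩
  refine ⟨⟨⟨M, hM.1.2⟩, hM.1.1, fun J hJ h1 => ?_⟩, hIM⟩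
  exact LIdeal.ext' fun a => ⟨fun h => hM.2 ⟨h1, J.solid⟩ hJ h, hJ a⟩

/-- The `ℓ`-ideal generated by a family of `ℓ`-ideals. -/
def LIdeal.span (c : Set (LIdeal A)) : LIdeal A :=
  LIdeal.ofSolid {x | ∃ y ∈ ⨆ I : c, I.1.toIdeal, |x| ≤ y}
    ⟨0, Ideal.zero_mem _, by rw [abs_zero]⟩
    (by
      rintro a b ⟨y, hy, hay⟩ ⟨z, hz, hbz⟩
      refine ⟨y + z, Ideal.add_mem _ hy hz, ?_⟩
      rw [abs_of_nonneg (add_nonneg (abs_nonneg a) (abs_nonneg b))]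
      exact add_le_add hay hbz)
    (by
      rintro a n - ⟨y, hy, hay⟩
      refine ⟨algebraMap ℝ A n * y, Ideal.mul_mem_left _ _ hy, ?_⟩
      have hn := algebraMap_nonneg' (A := A) (Nat.cast_nonneg n)
      rw [abs_of_nonneg (mul_nonneg hn (abs_nonneg a))]
      exact mul_le_mul_of_nonneg_left hay hn)
    (by
      rintro a b hab ⟨y, hy, hby⟩
      exact ⟨y, hy, hab.trans hby⟩)

lemma LIdeal.mem_span {c : Set (LIdeal A)} {x : A} :
    x ∈ LIdeal.span c ↔ ∃ y ∈ ⨆ I : c, I.1.toIdeal, |x| ≤ y := Iff.rfl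

lemma zeroSet_span (c : Set (LIdeal A)) : zeroSet (LIdeal.span c) = ⋂ I ∈ c, zeroSet I := by
  ext M
  simp only [Set.mem_iInter]
  constructor
  · intro h I hI a ha
    refine h a (LIdeal.mem_span.2 ⟨|a|, ?_, le_rfl⟩)
    exact Submodule.mem_iSup_of_mem (p := fun I : c => I.1.toIdeal) ⟨I, hI⟩ (LIdeal.abs_mem ha)
  · intro h a ha
    obtain ⟨y, hy, hay⟩ := LIdeal.mem_span.1 ha
    have : (⨆ I : c, I.1.toIdeal) ≤ M.1.toIdeal := iSup_le fun I => h I.1 I.2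
    exact LIdeal.mem_of_abs_le hay (this hy)

/-- The intersection of two `ℓ`-ideals. -/
def LIdeal.inter (I J : LIdeal A) : LIdeal A where
  toIdeal := I.toIdeal ⊓ J.toIdeal
  solid a b hab hb := ⟨I.solid a b hab hb.1, J.solid a b hab hb.2⟩

lemma zeroSet_inter (I J : LIdeal A) : zeroSet (I.inter J) = zeroSet I ∪ zeroSet J := by
  ext M
  constructor
  · intro h
    by_contra hne
    obtain ⟨hI, hJ⟩ := not_or.1 hne
    have hI' : ∃ a ∈ I, a ∉ M.1 := by simpa [zeroSet] using hI
    have hJ' : ∃ a ∈ J, a ∉ M.1 := by simpa [zeroSet] using hJ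
    obtain ⟨a, haI, haM⟩ := hI'
    obtain ⟨b, hbJ, hbM⟩ := hJ'
    have : |a| ⊓ |b| ∈ M.1 := h _
      ⟨LIdeal.mem_of_nonneg_le (le_inf (abs_nonneg a) (abs_nonneg b)) inf_le_left (LIdeal.abs_mem haI),
        LIdeal.mem_of_nonneg_le (le_inf (abs_nonneg a) (abs_nonneg b)) inf_le_right (LIdeal.abs_mem hbJ)⟩
    rcases M.2.mem_or_mem (abs_nonneg a) (abs_nonneg b) this with h | h
    · exact haM (LIdeal.mem_of_abs_le le_rfl h)
    · exact hbM (LIdeal.mem_of_abs_le le_rfl h)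
  · rintro (h | h) a ha
    · exact h a ha.1
    · exact h a ha.2

/-- The topology whose closed sets are exactly the sets `Z_ℓ(I)`. -/
instance : TopologicalSpace (Yosida A) :=
  TopologicalSpace.ofClosed {C | ∃ I : LIdeal A, zeroSet I = C}
    ⟨⟨⊤, fun _ _ _ _ => trivial⟩, Set.eq_empty_of_forall_notMem fun M hM => M.2.1 (hM 1 trivial)⟩
    (by
      intro c hc
      refine ⟨LIdeal.span {I | zeroSet I ∈ c}, ?_⟩
      rw [zeroSet_span]
      ext M
      simp only [Set.mem_iInter, Set.mem_sInter]
      constructor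
      · intro h C hC
        obtain ⟨I, rfl⟩ := hc hC
        exact h I hC
      · exact fun h I hI => h _ hI)
    (by
      rintro _ ⟨I, rfl⟩ _ ⟨J, rfl⟩
      exact ⟨I.inter J, zeroSet_inter I J⟩)

lemma isClosed_iff_zeroSet {C : Set (Yosida A)} : IsClosed C ↔ ∃ I : LIdeal A, zeroSet I = C := by
  rw [← isOpen_compl_iff]
  change Cᶜᶜ ∈ {C | ∃ I : LIdeal A, zeroSet I = C} ↔ _
  rw [compl_compl]
  rfl

lemma isClosed_mem (a : A) : IsClosed {M : Yosida A | a ∈ M.1} := by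
  let J : LIdeal A := LIdeal.ofSolid {x | ∃ n : ℕ, |x| ≤ algebraMap ℝ A n * |a|}
    ⟨0, by simp⟩
    (by
      rintro x y ⟨m, hm⟩ ⟨n, hn⟩
      refine ⟨m + n, ?_⟩
      rw [abs_of_nonneg (add_nonneg (abs_nonneg x) (abs_nonneg y)), Nat.cast_add, map_add, add_mul]
      exact add_le_add hm hn)
    (by
      rintro x n - ⟨m, hm⟩
      have hn := algebraMap_nonneg' (A := A) (Nat.cast_nonneg n)
      refine ⟨n * m, ?_⟩
      rw [abs_of_nonneg (mul_nonneg hn (abs_nonneg x)), Nat.cast_mul, map_mul, mul_assoc]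
      exact mul_le_mul_of_nonneg_left hm hn)
    (by
      rintro x y hxy ⟨n, hn⟩
      exact ⟨n, hxy.trans hn⟩)
  refine isClosed_iff_zeroSet.2 ⟨J, ?_⟩
  ext M
  constructor
  · intro h
    exact h a ⟨1, by simp⟩
  · rintro h x ⟨n, hn⟩
    exact LIdeal.mem_of_abs_le hn (M.1.toIdeal.mul_mem_left _ (LIdeal.abs_mem h))

instance : CompactSpace (Yosida A) := by
  refine compactSpace_of_finite_subfamily_closed fun {ι} t ht hempty => ?_
  choose I hI using fun i => isClosed_iff_zeroSet.1 (ht i)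
  have h1 : (1 : A) ∈ LIdeal.span (Set.range I) := by
    by_contra h
    obtain ⟨M, hM⟩ := LIdeal.exists_le_maximal _ h
    have hM' : M ∈ zeroSet (LIdeal.span (Set.range I)) := hM
    rw [zeroSet_span] at hM'
    have : M ∈ ⋂ i, t i := Set.mem_iInter.2 fun i => by
      rw [← hI i]
      exact Set.mem_iInter₂.1 hM' (I i) ⟨i, rfl⟩
    rw [hempty] at this
    exact this
  obtain ⟨y, hy, h1y⟩ := LIdeal.mem_span.1 h1
  have hy' : y ∈ ⨆ i, (I i).toIdeal := by
    refine (iSup_le ?_ : (⨆ J : Set.range I, J.1.toIdeal) ≤ ⨆ i, (I i).toIdeal) hy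
    rintro ⟨_, i, rfl⟩
    exact le_iSup (fun i => (I i).toIdeal) i
  obtain ⟨s, hs⟩ := Submodule.exists_finset_of_mem_iSup _ hy'
  refine ⟨s, Set.eq_empty_of_forall_notMem fun M hM => M.2.1 ?_⟩
  have hle : (⨆ i ∈ s, (I i).toIdeal) ≤ M.1.toIdeal := iSup₂_le fun i hi => by
    have : M ∈ t i := Set.mem_iInter₂.1 hM i hi
    rw [← hI i] at this
    exact this
  exact LIdeal.mem_of_abs_le h1y (hle hs)

instance : T2Space (Yosida A) := by
  refine ⟨fun M N hMN => ?_⟩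
  have hex : ∃ a ∈ M.1, a ∉ N.1 := by
    by_contra! h
    exact hMN (Yosida.ext (M.2.2 N.1 h N.2.1).symm)
  obtain ⟨a, haM, haN⟩ := hex
  have hε : ∃ ε : ℝ, 0 < ε ∧ (|a| - algebraMap ℝ A ε) ⊔ 0 ∉ N.1 := by
    by_contra! h
    exact haN (N.2.mem_of_infinitesimal h)
  obtain ⟨ε, hε, hN⟩ := hε
  have hM : (algebraMap ℝ A ε - |a|) ⊔ 0 ∉ M.1 := by
    intro h
    refine LIdeal.one_notMem_of_algebraMap M.2.1 hε.ne' ?_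
    refine LIdeal.mem_of_nonneg_le (algebraMap_nonneg' hε.le) ?_ (M.1.toIdeal.add_mem h (LIdeal.abs_mem haM))
    rw [← sub_le_iff_le_add]
    exact le_sup_left
  refine ⟨{M | (algebraMap ℝ A ε - |a|) ⊔ 0 ∈ M.1}ᶜ, {M | (|a| - algebraMap ℝ A ε) ⊔ 0 ∈ M.1}ᶜ,
    (isClosed_mem _).isOpen_compl, (isClosed_mem _).isOpen_compl, hM, hN, ?_⟩
  rw [Set.disjoint_left]
  intro P hP hP'
  have h0 : ((|a| - algebraMap ℝ A ε) ⊔ 0) ⊓ ((algebraMap ℝ A ε - |a|) ⊔ 0) = 0 := by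
    have := posPart_inf_negPart_eq_zero (|a| - algebraMap ℝ A ε)
    rwa [posPart_def, negPart_def, neg_sub] at this
  rcases P.2.mem_or_mem le_sup_right le_sup_right (h0 ▸ P.1.toIdeal.zero_mem) with h | h
  · exact hP' h
  · exact hP h

end Yosida

section YosidaMap

variable {A B : Type u} [CommRing A] [Lattice A] [Algebra ℝ A] [BddLAlgebra A]
  [CommRing B] [Lattice B] [Algebra ℝ B] [BddLAlgebra B]

lemma LIdeal.comap_isMaximal (f : LHom A B) {M : LIdeal B} (hM : M.IsMaximal) :
    (LIdeal.comap f M).IsMaximal := by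
  refine ⟨fun h => hM.1 ?_, fun J hJ h1 => ?_⟩
  · rwa [LIdeal.mem_comap, map_one] at h
  · refine LIdeal.ext' fun a => ⟨fun ha => ?_, hJ a⟩
    obtain ⟨r, hr⟩ := hM.exists_sub_mem (f a)
    have h2 : a - algebraMap ℝ A r ∈ J := hJ _ (by
      rwa [LIdeal.mem_comap, map_sub, LHom.map_alg])
    have h3 : algebraMap ℝ A r ∈ J := by
      have := J.toIdeal.sub_mem ha h2
      rwa [sub_sub_cancel] at this
    have h4 : r = 0 := by
      by_contra hr0
      exact LIdeal.one_notMem_of_algebraMap h1 hr0 h3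
    rw [LIdeal.mem_comap]
    simpa [h4] using hr

/-- The map `α⁻¹ : Y_B → Y_A` induced by `α : A → B`. -/
def yosidaMap (f : LHom A B) : C(Yosida B, Yosida A) where
  toFun M := ⟨LIdeal.comap f M.1, LIdeal.comap_isMaximal f M.2⟩
  continuous_toFun := by
    rw [continuous_iff_isClosed]
    intro C hC
    obtain ⟨I, rfl⟩ := isClosed_iff_zeroSet.1 hC
    have : (fun M : Yosida B => (⟨LIdeal.comap f M.1, LIdeal.comap_isMaximal f M.2⟩ : Yosida A)) ⁻¹'
        zeroSet I = ⋂ a ∈ {a | a ∈ I}, {M : Yosida B | f a ∈ M.1} := by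
      ext M
      simp only [Set.mem_iInter]
      rfl
    rw [this]
    exact isClosed_biInter fun a _ => isClosed_mem (f a)

end YosidaMap

/-- The contravariant functor `Y` from bounded archimedean `ℓ`-algebras to compact Hausdorff
spaces. -/
def Y : BAL.{u}ᵒᵖ ⥤ CompHaus.{u} where
  obj A := CompHaus.of (Yosida A.unop)
  map f := CompHausLike.ofHom _ (yosidaMap f.unop)

/-! ### Rings of continuous functions and uniform completeness -/

instance (X : Type u) [TopologicalSpace X] [CompactSpace X] : BddLAlgebra C(X, ℝ) where
  add_le_add_right' f g h hfg := fun x => add_le_add_left (hfg x) (h x)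
  mul_nonneg' f g hf hg := fun x => mul_nonneg (hf x) (hg x)
  smul_nonneg' r f hr hf := fun x => mul_nonneg hr (hf x)
  bounded' f := by
    obtain ⟨n, hn⟩ := exists_nat_ge ‖f‖
    refine ⟨n, fun x => ?_⟩
    have := (le_abs_self (f x)).trans ((f.norm_coe_le_norm x).trans hn)
    simpa using this

lemma continuousMap_isArch (X : Type u) [TopologicalSpace X] : IsArch C(X, ℝ) := fun f g h x => by
  by_contra hx
  have hx' : 0 < f x := not_le.1 hx
  obtain ⟨n, hn⟩ := exists_nat_gt (g x / f x)
  rw [div_lt_iff₀ hx'] at hn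
  have : n • f x ≤ g x := h n x
  rw [nsmul_eq_mul] at this
  linarith

/-- The norm of `A` is complete. -/
def IsUniformlyComplete : ObjectProperty BAL.{u} := fun A =>
  ∀ s : ℕ → A, (∀ ε : ℝ, 0 < ε → ∃ N, ∀ m ≥ N, ∀ n ≥ N, nrm (s m - s n) < ε) →
    ∃ a : A, ∀ ε : ℝ, 0 < ε → ∃ N, ∀ n ≥ N, nrm (s n - a) < ε

/-- The category of uniformly complete bounded archimedean `ℓ`-algebras. -/
abbrev UBAL : Type (u + 1) := (IsUniformlyComplete.{u}).FullSubcategory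

lemma nrm_continuousMap {X : Type u} [TopologicalSpace X] [CompactSpace X] (f : C(X, ℝ)) :
    nrm f = ‖f‖ := by
  have habs : ∀ r : ℝ, |f| ≤ algebraMap ℝ C(X, ℝ) r ↔ ∀ x, ‖f x‖ ≤ r := fun r => by
    rw [ContinuousMap.le_def]
    refine forall_congr' fun x => ?_
    change |f| x ≤ algebraMap ℝ C(X, ℝ) r x ↔ _
    rw [ContinuousMap.abs_apply, Real.norm_eq_abs, algebraMap_apply]
    simp
  refine le_antisymm (nrm_le (norm_nonneg f) ((habs _).2 f.norm_coe_le_norm)) ?_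
  exact (ContinuousMap.norm_le f (nrm_nonneg f)).2
    ((habs _).1 (abs_le_nrm (continuousMap_isArch X) f))

lemma continuousMap_isUniformlyComplete (X : Type u) [TopologicalSpace X] [CompactSpace X] :
    IsUniformlyComplete { carrier := C(X, ℝ), arch := continuousMap_isArch X } := fun s hs => by
  change ℕ → C(X, ℝ) at s
  have hcs : CauchySeq s := Metric.cauchySeq_iff.2 fun ε hε => by
    obtain ⟨N, hN⟩ := hs ε hε
    refine ⟨N, fun m hm n hn => ?_⟩
    rw [dist_eq_norm, ← nrm_continuousMap]
    exact hN m hm n hn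
  obtain ⟨f, hf⟩ := cauchySeq_tendsto_of_complete hcs
  refine ⟨f, fun ε hε => ?_⟩
  obtain ⟨N, hN⟩ := Metric.tendsto_atTop.1 hf ε hε
  refine ⟨N, fun n hn => ?_⟩
  have := hN n hn
  rw [dist_eq_norm, ← nrm_continuousMap] at this
  exact this

/-- The algebra `C(X)` for a compact Hausdorff space `X`. -/
def CObj (X : CompHaus.{u}) : UBAL.{u} where
  obj := { carrier := C(X, ℝ), arch := continuousMap_isArch X }
  property := continuousMap_isUniformlyComplete X

/-- Composition with `φ : X → Y`, as an `ℓ`-algebra morphism `C(Y) → C(X)`. -/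
def compHom {X Y : Type u} [TopologicalSpace X] [TopologicalSpace Y] (φ : C(X, Y)) :
    LHom C(Y, ℝ) C(X, ℝ) where
  toAlgHom := ContinuousMap.compRightAlgHom ℝ ℝ φ
  map_sup' _ _ := rfl
  map_inf' _ _ := rfl

/-- The contravariant functor `C` from compact Hausdorff spaces to uniformly complete bounded
archimedean `ℓ`-algebras. -/
def C : CompHaus.{u}ᵒᵖ ⥤ UBAL.{u} where
  obj X := CObj X.unop
  map φ := ObjectProperty.homMk (compHom φ.unop.hom.hom)

/-- The endofunctor `Hᵘ = C ∘ Y ∘ H`. -/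
noncomputable def Hu : UBAL.{u} ⥤ UBAL.{u} :=
  ObjectProperty.ι _ ⋙ H ⋙ Y.rightOp ⋙ C

/-! ### Clean algebras -/

/-- Every element is the sum of an idempotent and a unit. -/
def IsClean : ObjectProperty UBAL.{u} := fun A =>
  ∀ a : A.obj, ∃ e v : A.obj, IsIdempotentElem e ∧ IsUnit v ∧ a = e + v

/-- The category of clean uniformly complete bounded archimedean `ℓ`-algebras. -/
abbrev CUBAL : Type (u + 1) := (IsClean.{u}).FullSubcategory

/-- The restriction of `Hᵘ` to clean algebras, given that `Hᵘ` preserves cleanness. -/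
noncomputable def Hc (h : ∀ A : CUBAL.{u}, IsClean (Hu.obj A.obj)) : CUBAL.{u} ⥤ CUBAL.{u} :=
  ObjectProperty.lift _ (ObjectProperty.ι _ ⋙ Hu) h

/-! ### The Vietoris endofunctor on Stone spaces -/

/-- The Vietoris space of a Stone space is totally disconnected. -/
instance (X : Type u) [TopologicalSpace X] [CompactSpace X] [T2Space X]
    [TotallyDisconnectedSpace X] : TotallyDisconnectedSpace (Compacts X) := by
  have key : ∀ K L : Compacts X, (∃ x ∈ K, x ∉ L) →
      ∃ U : Set (Compacts X), IsClopen U ∧ K ∈ U ∧ L ∉ U := by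
    rintro K L ⟨x, hK, hL⟩
    obtain ⟨V, hV, hxV, hVL⟩ :=
      compact_exists_isClopen_in_isOpen L.isCompact.isClosed.isOpen_compl hL
    refine ⟨{S | ((S : Set X) ∩ V).Nonempty},
      ⟨Compacts.isClosed_inter_nonempty_of_isClosed hV.1,
        Compacts.isOpen_inter_nonempty_of_isOpen hV.2⟩, ⟨x, hK, hxV⟩, ?_⟩
    rintro ⟨y, hyL, hyV⟩
    exact hVL hyV hyL
  refine @TotallySeparatedSpace.totallyDisconnectedSpace _ _
    (totallySeparatedSpace_iff_exists_isClopen.2 fun K L hKL => ?_)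
  by_cases h : ∃ x ∈ K, x ∉ L
  · exact key K L h
  · have h' : ∃ x ∈ L, x ∉ K := by
      by_contra! h2
      push Not at h
      exact hKL (SetLike.ext fun x => ⟨h x, h2 x⟩)
    obtain ⟨U, hU, hL, hK⟩ := key L K h'
    exact ⟨Uᶜ, hU.compl, hK, fun h => h hL⟩

/-- The Vietoris endofunctor: `X` is sent to the space of its closed (equivalently, compact)
subsets with the Vietoris topology, and a continuous map to the direct image map. -/
def VS : Profinite.{u} ⥤ Profinite.{u} where
  obj X := Profinite.of (Compacts X)
  map f := CompHausLike.ofHom _ ⟨Compacts.map f f.hom.hom.continuous,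
    f.hom.hom.continuous.compacts_map⟩
  map_id X := by
    ext K
    exact SetLike.ext_iff.1 (Compacts.map_id K) _
  map_comp f g := by
    ext K
    exact SetLike.ext_iff.1
      (Compacts.map_comp g f g.hom.hom.continuous f.hom.hom.continuous K) _

end Bal

namespace Bal

/-! ### The Gelfand transform -/

section Gelfand

variable {A : Type u} [CommRing A] [Lattice A] [Algebra ℝ A] [BddLAlgebra A]

lemma algebraMap_sup (r s : ℝ) : algebraMap ℝ A (r ⊔ s) = algebraMap ℝ A r ⊔ algebraMap ℝ A s :=
  Monotone.map_sup (f := algebraMap ℝ A) (fun _ _ h => algebraMap_mono h) r s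

lemma algebraMap_inf (r s : ℝ) : algebraMap ℝ A (r ⊓ s) = algebraMap ℝ A r ⊓ algebraMap ℝ A s :=
  Monotone.map_inf (f := algebraMap ℝ A) (fun _ _ h => algebraMap_mono h) r s

/-- The real number to which `a` is congruent modulo the maximal `ℓ`-ideal `M`. -/
noncomputable def val (a : A) (M : Yosida A) : ℝ := (M.2.exists_sub_mem a).choose

lemma sub_val_mem (a : A) (M : Yosida A) : a - algebraMap ℝ A (val a M) ∈ M.1 :=
  (M.2.exists_sub_mem a).choose_spec

lemma val_eq {a : A} {M : Yosida A} {r : ℝ} (h : a - algebraMap ℝ A r ∈ M.1) : val a M = r := by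
  by_contra hne
  refine LIdeal.one_notMem_of_algebraMap M.2.1 (sub_ne_zero.2 hne) ?_
  have := M.1.toIdeal.sub_mem h (sub_val_mem a M)
  rwa [sub_sub_sub_cancel_left, ← map_sub] at this

lemma val_eq_zero {a : A} {M : Yosida A} : val a M = 0 ↔ a ∈ M.1 := by
  constructor
  · intro h
    simpa [h] using sub_val_mem a M
  · intro h
    exact val_eq (by simpa using h)

lemma val_add (a b : A) (M : Yosida A) : val (a + b) M = val a M + val b M := by
  refine val_eq ?_
  rw [map_add, add_sub_add_comm]
  exact M.1.toIdeal.add_mem (sub_val_mem a M) (sub_val_mem b M)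

lemma val_mul (a b : A) (M : Yosida A) : val (a * b) M = val a M * val b M := by
  refine val_eq ?_
  have : a * b - algebraMap ℝ A (val a M * val b M) =
      b * (a - algebraMap ℝ A (val a M)) + algebraMap ℝ A (val a M) *
        (b - algebraMap ℝ A (val b M)) := by
    rw [map_mul]; ring
  rw [this]
  exact M.1.toIdeal.add_mem (M.1.toIdeal.mul_mem_left _ (sub_val_mem a M))
    (M.1.toIdeal.mul_mem_left _ (sub_val_mem b M))

lemma val_algebraMap (r : ℝ) (M : Yosida A) : val (algebraMap ℝ A r) M = r :=
  val_eq (by rw [sub_self]; exact M.1.toIdeal.zero_mem)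

lemma val_sup (a b : A) (M : Yosida A) : val (a ⊔ b) M = val a M ⊔ val b M := by
  refine val_eq ?_
  rw [algebraMap_sup]
  exact LIdeal.sup_sub_sup_mem (sub_val_mem a M) (sub_val_mem b M)

lemma val_inf (a b : A) (M : Yosida A) : val (a ⊓ b) M = val a M ⊓ val b M := by
  refine val_eq ?_
  rw [algebraMap_inf]
  exact LIdeal.inf_sub_inf_mem (sub_val_mem a M) (sub_val_mem b M)

lemma val_sub_algebraMap (a : A) (r : ℝ) (M : Yosida A) :
    val (a - algebraMap ℝ A r) M = val a M - r := by
  have := val_add (a - algebraMap ℝ A r) (algebraMap ℝ A r) M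
  rw [sub_add_cancel, val_algebraMap] at this
  linarith

lemma continuous_val (a : A) : Continuous (val a) := by
  have hle : ∀ r : ℝ, IsClosed {M : Yosida A | val a M ≤ r} := fun r => by
    convert isClosed_mem ((a - algebraMap ℝ A r) ⊔ 0) using 3 with M
    rw [← val_eq_zero, val_sup, val_sub_algebraMap, ← map_zero (algebraMap ℝ A),
      val_algebraMap, sup_eq_right, sub_nonpos]
  have hge : ∀ r : ℝ, IsClosed {M : Yosida A | r ≤ val a M} := fun r => by
    convert isClosed_mem ((a - algebraMap ℝ A r) ⊓ 0) using 3 with M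
    rw [← val_eq_zero, val_inf, val_sub_algebraMap, ← map_zero (algebraMap ℝ A),
      val_algebraMap, inf_eq_right, sub_nonneg]
  rw [continuous_iff_lower_upperSemicontinuous]
  exact ⟨lowerSemicontinuous_iff_isClosed_preimage.2 hle,
    upperSemicontinuous_iff_isClosed_preimage.2 hge⟩

variable (A) in
/-- The Gelfand transform `A → C(Y_A)`. -/
noncomputable def gelfand : LHom A C(Yosida A, ℝ) where
  toFun a := ⟨val a, continuous_val a⟩
  map_one' := by
    ext M
    simpa using val_algebraMap (A := A) 1 M
  map_mul' a b := ContinuousMap.ext (val_mul a b)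
  map_zero' := by
    ext M
    simpa using val_algebraMap (A := A) 0 M
  map_add' a b := ContinuousMap.ext (val_add a b)
  commutes' r := ContinuousMap.ext (val_algebraMap r)
  map_sup' a b := ContinuousMap.ext (val_sup a b)
  map_inf' a b := ContinuousMap.ext (val_inf a b)

lemma gelfand_eq_zero {a : A} {M : Yosida A} : gelfand A a M = 0 ↔ a ∈ M.1 := val_eq_zero

/-- The Gelfand transform is natural. -/
lemma gelfand_map {B : Type u} [CommRing B] [Lattice B] [Algebra ℝ B] [BddLAlgebra B]
    (f : LHom A B) (a : A) (N : Yosida B) :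
    gelfand B (f a) N = gelfand A a (yosidaMap f N) := by
  refine val_eq ?_
  have := sub_val_mem a (yosidaMap f N)
  change f _ ∈ N.1 at this
  rwa [map_sub, LHom.map_alg] at this

/-- A nonzero element of an archimedean algebra avoids some maximal `ℓ`-ideal. -/
lemma exists_notMem_of_pos (hA : IsArch A) {a : A} (h0 : 0 ≤ a) (ha : a ≠ 0) :
    ∃ M : Yosida A, a ∉ M.1 := by
  obtain ⟨n, hn⟩ : ∃ n : ℕ, ¬ n • a ≤ 1 := by
    by_contra! h
    exact ha (le_antisymm (hA a 1 h) h0)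
  have hw : 0 ≤ (n • a - 1)⁺ := posPart_nonneg _
  let I : LIdeal A := LIdeal.ofSolid {x | |x| ⊓ (n • a - 1)⁺ = 0}
    (by rw [Set.mem_ofPred_eq, abs_zero, inf_eq_left.2 hw])
    (by
      intro x y hx hy
      rw [Set.mem_ofPred_eq] at *
      refine le_antisymm ?_ (le_inf (abs_nonneg _) hw)
      rw [abs_of_nonneg (add_nonneg (abs_nonneg x) (abs_nonneg y))]
      refine (add_inf_le (abs_nonneg x) (abs_nonneg y) hw).trans ?_
      rw [hx, hy, add_zero])
    (by
      intro x m hm hx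
      rw [Set.mem_ofPred_eq] at *
      refine le_antisymm ?_ (le_inf (abs_nonneg _) hw)
      rw [abs_of_nonneg (mul_nonneg (algebraMap_nonneg' (Nat.cast_nonneg m)) (abs_nonneg x))]
      refine (nsmul_inf_le hw hm).trans ?_
      rw [hx, mul_zero])
    (by
      intro x y hxy hy
      rw [Set.mem_ofPred_eq] at *
      exact le_antisymm ((inf_le_inf_right _ hxy).trans hy.le) (le_inf (abs_nonneg _) hw))
  have hI : ∀ x, x ∈ I ↔ |x| ⊓ (n • a - 1)⁺ = 0 := fun x => Iff.rfl
  have h1 : (1 : A) ∉ I := by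
    rw [hI, abs_of_nonneg zero_le_one']
    intro h
    obtain ⟨m, hm, hle⟩ := exists_abs_le (n • a - 1)⁺
    have h2 := nsmul_inf_le (x := (1 : A)) hw hm
    rw [h, mul_zero, mul_one, inf_eq_right.2 ((le_abs_self _).trans hle)] at h2
    exact hn (sub_nonpos.1 (posPart_nonpos.1 h2))
  obtain ⟨M, hM⟩ := LIdeal.exists_le_maximal I h1
  refine ⟨M, fun haM => ?_⟩
  have h3 : (n • a - 1)⁻ ∈ I := by
    rw [hI, abs_of_nonneg (negPart_nonneg _), inf_comm]
    exact posPart_inf_negPart_eq_zero _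
  have h4 := val_eq_zero.2 (hM _ h3)
  have h5 : gelfand A a M = 0 := val_eq_zero.2 haM
  have h6 : gelfand A (-(n • a - 1) ⊔ 0) M = 0 := h4
  rw [map_sup, map_neg, map_sub, map_nsmul, map_one, map_zero] at h6
  simp [h5] at h6

lemma gelfand_injective (hA : IsArch A) : Function.Injective (gelfand A) := by
  rw [injective_iff_map_eq_zero]
  intro a ha
  by_contra hne
  obtain ⟨M, hM⟩ := exists_notMem_of_pos hA (abs_nonneg a) fun h =>
    hne (le_antisymm (h ▸ le_abs_self a) (neg_nonpos.1 (h ▸ neg_le_abs a)))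
  refine hM (LIdeal.abs_mem (val_eq_zero.1 ?_))
  exact DFunLike.congr_fun ha M

/-- The Gelfand transform reflects the order. -/
lemma gelfand_le_gelfand (hA : IsArch A) {a b : A} : gelfand A a ≤ gelfand A b ↔ a ≤ b := by
  rw [← sup_eq_right, ← map_sup, (gelfand_injective hA).eq_iff, sup_eq_right]

lemma nrm_gelfand (hA : IsArch A) (a : A) : nrm a = ‖gelfand A a‖ := by
  rw [← nrm_continuousMap]
  refine le_antisymm (nrm_le (nrm_nonneg _) ?_) (nrm_map_le hA _ a)
  rw [← gelfand_le_gelfand hA, LHom.map_abs', LHom.map_alg]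
  exact abs_le_nrm (continuousMap_isArch _) _

lemma gelfand_surjective (A : UBAL.{u}) : Function.Surjective (gelfand A.obj) := by
  intro f
  have hsep : (gelfand A.obj).toAlgHom.range.SeparatesPoints := by
    intro M N hMN
    have hex : ∃ a ∈ M.1, a ∉ N.1 := by
      by_contra! h
      exact hMN (Yosida.ext (M.2.2 N.1 h N.2.1).symm)
    obtain ⟨a, haM, haN⟩ := hex
    refine ⟨_, ⟨gelfand A.obj a, ⟨a, rfl⟩, rfl⟩, ?_⟩
    exact fun h => haN (gelfand_eq_zero.1 (h.symm.trans (gelfand_eq_zero.2 haM)))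
  have htop := ContinuousMap.subalgebra_topologicalClosure_eq_top_of_separatesPoints _ hsep
  have hf : f ∈ closure (Set.range (gelfand A.obj)) := by
    have : f ∈ (gelfand A.obj).toAlgHom.range.topologicalClosure := by rw [htop]; trivial
    exact this
  obtain ⟨x, hx, hlim⟩ := mem_closure_iff_seq_limit.1 hf
  choose a ha using hx
  obtain ⟨b, hb⟩ := A.property a fun ε hε => by
    obtain ⟨N, hN⟩ := Metric.cauchySeq_iff.1 hlim.cauchySeq ε hε
    refine ⟨N, fun m hm n hn => ?_⟩
    rw [nrm_gelfand A.obj.arch, map_sub, ha, ha, ← dist_eq_norm]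
    exact hN m hm n hn
  refine ⟨b, tendsto_nhds_unique (f := x) (l := Filter.atTop) ?_ hlim⟩
  refine Metric.tendsto_atTop.2 fun ε hε => ?_
  obtain ⟨N, hN⟩ := hb ε hε
  refine ⟨N, fun n hn => ?_⟩
  rw [dist_eq_norm, ← ha, ← map_sub, ← nrm_gelfand A.obj.arch]
  exact hN n hn

/-- The Gelfand transform of a uniformly complete algebra is an isomorphism of rings. -/
noncomputable def gelfandEquiv (A : UBAL.{u}) : A.obj ≃+* C(Yosida A.obj, ℝ) :=
  RingEquiv.ofBijective (gelfand A.obj) ⟨gelfand_injective A.obj.arch, gelfand_surjective A⟩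

end Gelfand

end Bal

namespace Bal

/-! ### The Yosida space of an algebra of continuous functions -/

section Evaluation

variable {X : Type u} [TopologicalSpace X] [CompactSpace X]

/-- The `ℓ`-ideal of the functions vanishing at `x`. -/
def vanishingIdeal (x : X) : LIdeal C(X, ℝ) where
  toIdeal := RingHom.ker (ContinuousMap.evalAlgHom ℝ ℝ x)
  solid a b hab hb := by
    have h1 : |a x| ≤ |b x| := hab x
    have h2 : b x = 0 := hb
    rw [h2, abs_zero] at h1
    exact abs_nonpos_iff.1 h1

lemma mem_vanishingIdeal {x : X} {f : C(X, ℝ)} : f ∈ vanishingIdeal x ↔ f x = 0 := Iff.rfl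

lemma vanishingIdeal_isMaximal (x : X) : (vanishingIdeal x).IsMaximal := by
  refine ⟨fun h => one_ne_zero (mem_vanishingIdeal.1 h), fun J hJ h1 => ?_⟩
  refine LIdeal.ext' fun f => ⟨fun hf => ?_, hJ f⟩
  by_contra hfx
  refine LIdeal.one_notMem_of_algebraMap h1 (r := f x) hfx ?_
  have h2 := J.toIdeal.sub_mem hf (hJ (f - algebraMap ℝ C(X, ℝ) (f x)) (by
    rw [mem_vanishingIdeal, ContinuousMap.sub_apply, algebraMap_apply]
    simp))
  rwa [sub_sub_cancel] at h2

variable (X) in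
/-- The map sending a point to the ideal of the functions vanishing there. -/
def evalMap : C(X, Yosida C(X, ℝ)) where
  toFun x := ⟨vanishingIdeal x, vanishingIdeal_isMaximal x⟩
  continuous_toFun := by
    rw [continuous_iff_isClosed]
    intro C hC
    obtain ⟨I, rfl⟩ := isClosed_iff_zeroSet.1 hC
    have : (fun x : X => (⟨vanishingIdeal x, vanishingIdeal_isMaximal x⟩ : Yosida C(X, ℝ))) ⁻¹'
        zeroSet I = ⋂ f ∈ {f | f ∈ I}, {x | f x = 0} := by
      ext x
      simp only [Set.mem_iInter]
      rfl
    rw [this]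
    exact isClosed_biInter fun f _ => isClosed_eq f.continuous continuous_const

lemma mem_evalMap {x : X} {f : C(X, ℝ)} : f ∈ (evalMap X x).1 ↔ f x = 0 := Iff.rfl

lemma evalMap_surjective : Function.Surjective (evalMap X) := by
  intro M
  have hne : (⋂ f : {f : C(X, ℝ) // f ∈ M.1}, {x | f.1 x = 0}).Nonempty := by
    have : Nonempty {f : C(X, ℝ) // f ∈ M.1} := ⟨⟨0, M.1.toIdeal.zero_mem⟩⟩
    have hcl : ∀ f : {f : C(X, ℝ) // f ∈ M.1}, IsClosed {x | f.1 x = 0} := fun f =>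
      isClosed_eq f.1.continuous continuous_const
    refine IsCompact.nonempty_iInter_of_directed_nonempty_isCompact_isClosed _ ?_ ?_
      (fun f => (hcl f).isCompact) hcl
    · intro f g
      refine ⟨⟨|f.1| + |g.1|, M.1.toIdeal.add_mem (LIdeal.abs_mem f.2) (LIdeal.abs_mem g.2)⟩,
        fun x hx => ?_, fun x hx => ?_⟩
      all_goals
        have hx' : |f.1 x| + |g.1 x| = 0 := hx
        have h1 := abs_nonneg (f.1 x)
        have h2 := abs_nonneg (g.1 x)
        exact abs_nonpos_iff.1 (by linarith)
    · intro f
      by_contra hemp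
      have hu : IsUnit f.1 := (ContinuousMap.isUnit_iff_forall_ne_zero _).2 fun x hx => hemp ⟨x, hx⟩
      exact M.2.1 ((Ideal.eq_top_iff_one _).1 (Ideal.eq_top_of_isUnit_mem _ f.2 hu))
  obtain ⟨x, hx⟩ := hne
  rw [Set.mem_iInter] at hx
  exact ⟨x, Yosida.ext (M.2.2 _ (fun f hf => hx ⟨f, hf⟩) (vanishingIdeal_isMaximal x).1)⟩

lemma evalMap_injective [T2Space X] : Function.Injective (evalMap X) := by
  intro x y hxy
  by_contra hne
  obtain ⟨f, hfx, hfy, -⟩ := exists_continuous_zero_one_of_isClosed (isClosed_singleton (x := x))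
    (isClosed_singleton (x := y)) (Set.disjoint_singleton.2 hne)
  have h1 : f ∈ (evalMap X x).1 := hfx rfl
  rw [hxy, mem_evalMap, hfy rfl] at h1
  exact one_ne_zero h1

variable (X) in
/-- A compact Hausdorff space is homeomorphic to the Yosida space of its algebra of continuous
functions. -/
noncomputable def evalHomeo [T2Space X] : X ≃ₜ Yosida C(X, ℝ) :=
  (evalMap X).continuous.homeoOfEquivCompactToT2
    (f := Equiv.ofBijective (evalMap X) ⟨evalMap_injective, evalMap_surjective⟩)

end Evaluation

/-! ### Clean algebras and Stone spaces -/

lemma isClean_CObj (X : CompHaus.{u}) [TotallyDisconnectedSpace X] : IsClean (CObj X) := by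
  intro f
  change C(X, ℝ) at f
  obtain ⟨U, hU, hZU, hUV⟩ := exists_clopen_of_closed_subset_open
    (Z := {x | f x ≤ 1 / 3}) (U := {x | f x < 2 / 3})
    (isClosed_le f.continuous continuous_const) (isOpen_lt f.continuous continuous_const)
    (fun x hx => lt_of_le_of_lt (b := (1 / 3 : ℝ)) hx (by norm_num))
  let e : C(X, ℝ) := ⟨U.indicator 1, (IsClopen.continuous_indicator hU) continuous_one⟩
  have he1 : ∀ x ∈ U, e x = 1 := fun x hx => Set.indicator_of_mem hx _
  have he0 : ∀ x ∉ U, e x = 0 := fun x hx => Set.indicator_of_notMem hx _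
  refine ⟨e, f - e, ?_, ?_, (add_sub_cancel e f).symm⟩
  · refine ContinuousMap.ext fun x => ?_
    change e x * e x = e x
    by_cases hx : x ∈ U
    · rw [he1 x hx, one_mul]
    · rw [he0 x hx, zero_mul]
  · refine (ContinuousMap.isUnit_iff_forall_ne_zero (f - e : C(X, ℝ))).2 fun x => ?_
    rw [ContinuousMap.sub_apply]
    by_cases hx : x ∈ U
    · have : f x < 2 / 3 := hUV hx
      rw [he1 x hx]
      linarith
    · have : ¬ f x ≤ 1 / 3 := fun h => hx (hZU h)
      rw [he0 x hx]
      linarith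

lemma totallyDisconnected_of_isClean {A : UBAL.{u}} (hA : IsClean A) :
    TotallyDisconnectedSpace (Yosida A.obj) := by
  refine @TotallySeparatedSpace.totallyDisconnectedSpace _ _
    (totallySeparatedSpace_iff_exists_isClopen.2 fun M N hMN => ?_)
  obtain ⟨f, hfM, hfN, -⟩ := exists_continuous_zero_one_of_isClosed (isClosed_singleton (x := M))
    (isClosed_singleton (x := N)) (Set.disjoint_singleton.2 hMN)
  obtain ⟨a, rfl⟩ := gelfand_surjective A f
  obtain ⟨e, v, he, hv, rfl⟩ := hA a
  have he' : ∀ P, gelfand A.obj e P = 0 ∨ gelfand A.obj e P = 1 := fun P => by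
    have h1 : gelfand A.obj (e * e) P = gelfand A.obj e P := by rw [he]
    rw [map_mul, ContinuousMap.mul_apply] at h1
    exact IsIdempotentElem.iff_eq_zero_or_one.1 h1
  have hv' := (ContinuousMap.isUnit_iff_forall_ne_zero _).1 (hv.map (gelfand A.obj))
  have hM : gelfand A.obj e M + gelfand A.obj v M = 0 := by
    rw [← ContinuousMap.add_apply, ← map_add]
    exact hfM rfl
  have hN : gelfand A.obj e N + gelfand A.obj v N = 1 := by
    rw [← ContinuousMap.add_apply, ← map_add]
    exact hfN rfl
  have hset : {P | gelfand A.obj e P = 1} = {P | gelfand A.obj e P = 0}ᶜ := by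
    ext P
    rcases he' P with h | h <;> simp [h]
  refine ⟨{P | gelfand A.obj e P = 1}, ⟨isClosed_eq (ContinuousMap.continuous _) continuous_const,
    ?_⟩, (he' M).resolve_left fun h => hv' M (by linarith), fun h => hv' N ?_⟩
  · rw [hset]
    exact (isClosed_eq (ContinuousMap.continuous _) continuous_const).isOpen_compl
  · have : gelfand A.obj e N = 1 := h
    linarith

end Bal

namespace Bal

/-! ### Functionals that are infima over closed sets -/

section Infimum

variable {X : Type u} [TopologicalSpace X] [CompactSpace X]

/-- A functional that preserves meets, positive parts, translations by constants and nonnegative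
scalars is attained, at each function `f`, on the closed set where it is a lower bound for
evaluation. -/
lemma exists_lowerBound_attained {p : C(X, ℝ) → ℝ}
    (hinf : ∀ f g, p (f ⊓ g) = p f ⊓ p g) (hpos : ∀ f, p (f ⊔ 0) = p f ⊔ 0)
    (hadd : ∀ f r, p (f + algebraMap ℝ C(X, ℝ) r) = p f + r)
    (hsmul : ∀ (r : ℝ) f, 0 ≤ r → p (r • f) = r * p f) (f : C(X, ℝ)) :
    ∃ x, (∀ b, p b ≤ b x) ∧ f x ≤ p f := by
  have hmono : ∀ {a b : C(X, ℝ)}, a ≤ b → p a ≤ p b := fun {a b} hab => by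
    rw [← inf_eq_left, ← hinf, inf_eq_left.2 hab]
  have hsub : ∀ a : C(X, ℝ), p (a - algebraMap ℝ C(X, ℝ) (p a)) = 0 := fun a => by
    rw [sub_eq_add_neg, ← map_neg, hadd, add_neg_cancel]
  have happ : ∀ (a : C(X, ℝ)) (r : ℝ) (x : X), (a - algebraMap ℝ C(X, ℝ) r) x = a x - r :=
    fun a r x => by
      rw [ContinuousMap.sub_apply, algebraMap_apply]
      simp
  have happ' : ∀ (a : C(X, ℝ)) (r : ℝ) (x : X), (a + algebraMap ℝ C(X, ℝ) r) x = a x + r :=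
    fun a r x => by
      rw [ContinuousMap.add_apply, algebraMap_apply]
      simp
  have hne : (⋂ b : C(X, ℝ), {x | p b ≤ b x ∧ f x ≤ p f}).Nonempty := by
    have hcl : ∀ b : C(X, ℝ), IsClosed {x | p b ≤ b x ∧ f x ≤ p f} := fun b =>
      (isClosed_le continuous_const b.continuous).inter (isClosed_le f.continuous continuous_const)
    refine IsCompact.nonempty_iInter_of_directed_nonempty_isCompact_isClosed _ ?_ ?_
      (fun b => (hcl b).isCompact) hcl
    · intro b c
      refine ⟨(b - algebraMap ℝ C(X, ℝ) (p b)) ⊓ (c - algebraMap ℝ C(X, ℝ) (p c)), ?_, ?_⟩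
      all_goals
        rintro x ⟨h1, h2⟩
        rw [hinf, hsub, hsub, inf_idem, ContinuousMap.inf_apply, le_inf_iff, happ, happ,
          sub_nonneg, sub_nonneg] at h1
      · exact ⟨h1.1, h2⟩
      · exact ⟨h1.2, h2⟩
    · intro b
      by_contra hemp
      set a := f - algebraMap ℝ C(X, ℝ) (p f) with ha
      set c := b - algebraMap ℝ C(X, ℝ) (p b) with hc
      have hpos' : ∀ x, 0 < (a ⊔ -c) x := fun x => by
        rw [ContinuousMap.sup_apply, lt_sup_iff, ContinuousMap.neg_apply, ha, hc, happ, happ]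
        by_contra! h
        exact hemp ⟨x, by linarith [h.2], by linarith [h.1]⟩
      obtain ⟨δ, hδ, hδle⟩ := isCompact_univ.exists_forall_le' (a ⊔ -c).continuous.continuousOn
        (fun x _ => hpos' x)
      have hle : (c + algebraMap ℝ C(X, ℝ) (δ / 2)) ⊔ 0 ≤
          ((‖c + algebraMap ℝ C(X, ℝ) (δ / 2)‖ / δ) • a) ⊔ 0 := by
        intro x
        have h1 : c x + δ / 2 ≤ ‖c + algebraMap ℝ C(X, ℝ) (δ / 2)‖ := by
          rw [← happ']
          exact (le_abs_self _).trans ((c + algebraMap ℝ C(X, ℝ) (δ / 2)).norm_coe_le_norm x)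
        have h2 := hδle x trivial
        rw [ContinuousMap.sup_apply, le_sup_iff, ContinuousMap.neg_apply] at h2
        change (c + algebraMap ℝ C(X, ℝ) (δ / 2)) x ⊔ 0 ≤
          (‖c + algebraMap ℝ C(X, ℝ) (δ / 2)‖ / δ) * a x ⊔ 0
        rw [happ']
        rcases le_or_gt (c x + δ / 2) 0 with h3 | h3
        · exact (sup_le h3 le_rfl).trans le_sup_right
        · refine sup_le_sup_right (h1.trans ?_) 0
          have h4 : δ ≤ a x := h2.resolve_right (by linarith)
          rw [div_mul_eq_mul_div, le_div_iff₀ hδ]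
          exact mul_le_mul_of_nonneg_left h4 (norm_nonneg _)
      have := hmono hle
      rw [hpos, hpos, hadd, hsmul _ _ (by positivity), hc, ha, hsub, hsub, mul_zero, zero_add,
        sup_idem, sup_eq_left.2 (by positivity)] at this
      linarith
  obtain ⟨x, hx⟩ := hne
  rw [Set.mem_iInter] at hx
  exact ⟨x, fun b => (hx b).1, (hx f).2⟩

/-- The infimum of `f` over `K`, with the value `1` for `K = ∅`. -/
noncomputable def infOn (f : C(X, ℝ)) (K : Compacts X) : ℝ :=
  open scoped Classical in if (K : Set X).Nonempty then sInf (f '' K) else 1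

lemma infOn_of_empty {f : C(X, ℝ)} {K : Compacts X} (hK : ¬ (K : Set X).Nonempty) :
    infOn f K = 1 := if_neg hK

lemma exists_infOn_eq (f : C(X, ℝ)) {K : Compacts X} (hK : (K : Set X).Nonempty) :
    ∃ x ∈ K, infOn f K = f x := by
  obtain ⟨x, hx, h⟩ := K.isCompact.exists_sInf_image_eq hK f.continuous.continuousOn
  exact ⟨x, hx, by rw [infOn, if_pos hK, h]⟩

lemma infOn_le (f : C(X, ℝ)) {K : Compacts X} {x : X} (hx : x ∈ K) : infOn f K ≤ f x := by
  rw [infOn, if_pos ⟨x, hx⟩]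
  exact csInf_le (K.isCompact.image f.continuous).bddBelow ⟨x, hx, rfl⟩

lemma infOn_eq_of_forall_le {f : C(X, ℝ)} {K : Compacts X} {x : X} (hx : x ∈ K)
    (h : ∀ y ∈ K, f x ≤ f y) : infOn f K = f x := by
  obtain ⟨y, hy, h'⟩ := exists_infOn_eq f ⟨x, hx⟩
  exact le_antisymm (infOn_le f hx) (h' ▸ h y hy)

/-- For a monotone `φ : ℝ → ℝ`, taking the infimum commutes with applying `φ`. -/
lemma infOn_of_monotone {φ : ℝ → ℝ} (hφ : Monotone φ) {f g : C(X, ℝ)} (hg : ∀ x, g x = φ (f x))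
    {K : Compacts X} (hK : (K : Set X).Nonempty) : infOn g K = φ (infOn f K) := by
  obtain ⟨x, hx, h⟩ := exists_infOn_eq f hK
  rw [h, ← hg]
  refine infOn_eq_of_forall_le hx fun y hy => ?_
  rw [hg, hg]
  exact hφ (h ▸ infOn_le f hy)

lemma infOn_inf (f g : C(X, ℝ)) (K : Compacts X) : infOn (f ⊓ g) K = infOn f K ⊓ infOn g K := by
  by_cases hK : (K : Set X).Nonempty
  · refine le_antisymm (le_inf ?_ ?_) ?_
    · obtain ⟨x, hx, h⟩ := exists_infOn_eq f hK
      exact (infOn_le _ hx).trans (h ▸ inf_le_left)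
    · obtain ⟨x, hx, h⟩ := exists_infOn_eq g hK
      exact (infOn_le _ hx).trans (h ▸ inf_le_right)
    · obtain ⟨x, hx, h⟩ := exists_infOn_eq (f ⊓ g) hK
      rw [h]
      exact inf_le_inf (infOn_le f hx) (infOn_le g hx)
  · rw [infOn_of_empty hK, infOn_of_empty hK, infOn_of_empty hK, inf_idem]

lemma infOn_algebraMap (r : ℝ) {K : Compacts X} (hK : (K : Set X).Nonempty) :
    infOn (algebraMap ℝ C(X, ℝ) r) K = r := by
  obtain ⟨x, hx, h⟩ := exists_infOn_eq (algebraMap ℝ C(X, ℝ) r) hK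
  rw [h, algebraMap_apply]
  simp

lemma infOn_zero {K : Compacts X} (hK : (K : Set X).Nonempty) : infOn (0 : C(X, ℝ)) K = 0 := by
  rw [← map_zero (algebraMap ℝ C(X, ℝ)), infOn_algebraMap 0 hK]

lemma infOn_sup_zero (f : C(X, ℝ)) (K : Compacts X) : infOn (f ⊔ 0) K = infOn f K ⊔ 0 := by
  by_cases hK : (K : Set X).Nonempty
  · exact infOn_of_monotone (φ := fun t => t ⊔ 0) (fun _ _ h => sup_le_sup_right h 0)
      (fun _ => rfl) hK
  · rw [infOn_of_empty hK, infOn_of_empty hK, sup_eq_left.2 zero_le_one]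

lemma infOn_add_algebraMap (f : C(X, ℝ)) (r : ℝ) {K : Compacts X} (hK : (K : Set X).Nonempty) :
    infOn (f + algebraMap ℝ C(X, ℝ) r) K = infOn f K + r :=
  infOn_of_monotone (φ := fun t => t + r) (fun _ _ h => add_le_add_left h r)
    (fun x => by rw [ContinuousMap.add_apply, algebraMap_apply]; simp) hK

lemma infOn_smul {r : ℝ} (hr : 0 ≤ r) (f : C(X, ℝ)) {K : Compacts X}
    (hK : (K : Set X).Nonempty) : infOn (r • f) K = r * infOn f K :=
  infOn_of_monotone (φ := fun t => r * t) (fun _ _ h => mul_le_mul_of_nonneg_left h hr)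
    (fun _ => rfl) hK

lemma abs_infOn_le (f : C(X, ℝ)) (K : Compacts X) : |infOn f K| ≤ max ‖f‖ 1 := by
  by_cases hK : (K : Set X).Nonempty
  · obtain ⟨x, hx, h⟩ := exists_infOn_eq f hK
    rw [h]
    exact (f.norm_coe_le_norm x).trans (le_max_left _ _)
  · rw [infOn_of_empty hK, abs_one]
    exact le_max_right _ _

lemma infOn_map {Z : Type u} [TopologicalSpace Z] [CompactSpace Z] (φ : C(X, Z)) (f : C(Z, ℝ))
    (K : Compacts X) : infOn f (K.map φ φ.continuous) = infOn (f.comp φ) K := by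
  classical
  rw [infOn, infOn, Compacts.coe_map, ContinuousMap.coe_comp, Set.image_comp]
  exact if_congr Set.image_nonempty rfl rfl

lemma continuous_infOn (f : C(X, ℝ)) : Continuous (infOn f) := by
  have hne : IsClopen {K : Compacts X | (K : Set X).Nonempty} := by
    have : {K : Compacts X | (K : Set X).Nonempty} =
        {K : Compacts X | ((K : Set X) ∩ Set.univ).Nonempty} := by
      simp only [Set.inter_univ]
    rw [this]
    exact ⟨Compacts.isClosed_inter_nonempty_of_isClosed isClosed_univ,
      Compacts.isOpen_inter_nonempty_of_isOpen isOpen_univ⟩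
  rw [continuous_iff_lower_upperSemicontinuous, lowerSemicontinuous_iff_isOpen_preimage,
    upperSemicontinuous_iff_isOpen_preimage]
  refine ⟨fun r => ?_, fun r => ?_⟩
  · have : infOn f ⁻¹' Set.Ioi r = {K : Compacts X | (K : Set X) ⊆ {x | r < f x}} ∩
        ({K : Compacts X | (K : Set X).Nonempty} ∪ {_K | r < 1}) := by
      ext K
      constructor
      · intro hK
        refine ⟨fun x hx => lt_of_lt_of_le hK (infOn_le f hx), ?_⟩
        by_cases hemp : (K : Set X).Nonempty
        · exact Or.inl hemp
        · exact Or.inr (infOn_of_empty (f := f) hemp ▸ hK)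
      · rintro ⟨h1, h2⟩
        by_cases hemp : (K : Set X).Nonempty
        · obtain ⟨x, hx, h⟩ := exists_infOn_eq f hemp
          exact lt_of_lt_of_eq (h1 hx) h.symm
        · exact lt_of_lt_of_eq (h2.resolve_left hemp) (infOn_of_empty hemp).symm
    rw [this]
    exact (Compacts.isOpen_subsets_of_isOpen (isOpen_lt continuous_const f.continuous)).inter
      (hne.isOpen.union isOpen_const)
  · have : infOn f ⁻¹' Set.Iio r = {K : Compacts X | ((K : Set X) ∩ {x | f x < r}).Nonempty} ∪
        ({K : Compacts X | (K : Set X).Nonempty}ᶜ ∩ {_K | 1 < r}) := by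
      ext K
      constructor
      · intro hK
        by_cases hemp : (K : Set X).Nonempty
        · obtain ⟨x, hx, h⟩ := exists_infOn_eq f hemp
          exact Or.inl ⟨x, hx, lt_of_eq_of_lt h.symm hK⟩
        · exact Or.inr ⟨hemp, infOn_of_empty (f := f) hemp ▸ hK⟩
      · rintro (⟨x, hx, h⟩ | ⟨hemp, h⟩)
        · exact lt_of_le_of_lt (infOn_le f hx) h
        · exact lt_of_eq_of_lt (infOn_of_empty hemp) h
    rw [this]
    exact (Compacts.isOpen_inter_nonempty_of_isOpen
      (isOpen_lt f.continuous continuous_const)).union (hne.compl.isOpen.inter isOpen_const)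

/-- The closed sets determine the functionals. -/
lemma infOn_ext [T2Space X] {K L : Compacts X} (h : ∀ f : C(X, ℝ), infOn f K = infOn f L) :
    K = L := by
  have key : ∀ K L : Compacts X, (∀ f : C(X, ℝ), infOn f K = infOn f L) → K ≤ L := by
    intro K L h x hxK
    by_contra hxL
    by_cases hL : (L : Set X).Nonempty
    · obtain ⟨f, hfx, hfL, -⟩ := exists_continuous_zero_one_of_isClosed
        (isClosed_singleton (x := x)) L.isCompact.isClosed (Set.disjoint_singleton_left.2 hxL)
      obtain ⟨y, hy, h'⟩ := exists_infOn_eq f hL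
      have h1 := infOn_le f hxK
      rw [h, h', hfx rfl, hfL hy] at h1
      exact absurd h1 (by norm_num)
    · have h1 := h 0
      rw [infOn_of_empty hL, infOn_zero ⟨x, hxK⟩] at h1
      exact zero_ne_one h1
  exact le_antisymm (key K L h) (key L K fun f => (h f).symm)

end Infimum

end Bal

namespace Bal

/-! ### The Yosida space of `H(A)` -/

section YosidaH

/-- The kernel of a morphism, as an `ℓ`-ideal. -/
def LHom.ker {A B : Type u} [CommRing A] [Lattice A] [Algebra ℝ A] [LAlgebra A]
    [CommRing B] [Lattice B] [Algebra ℝ B] [LAlgebra B] (f : LHom A B) : LIdeal A where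
  toIdeal := RingHom.ker f.toAlgHom
  solid a b hab hb := by
    have h1 : |f a| ≤ |f b| := by
      rw [← f.map_abs', ← f.map_abs']
      exact f.mono hab
    have h2 : f b = 0 := hb
    rw [h2, abs_zero] at h1
    exact le_antisymm ((le_abs_self _).trans h1) (neg_nonpos.1 ((neg_le_abs _).trans h1))

lemma LHom.mem_ker {A B : Type u} [CommRing A] [Lattice A] [Algebra ℝ A] [LAlgebra A]
    [CommRing B] [Lattice B] [Algebra ℝ B] [LAlgebra B] {f : LHom A B} {a : A} :
    a ∈ f.ker ↔ f a = 0 := Iff.rfl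

lemma LHom.ker_isArchimedean {A B : Type u} [CommRing A] [Lattice A] [Algebra ℝ A] [LAlgebra A]
    [CommRing B] [Lattice B] [Algebra ℝ B] [LAlgebra B] (f : LHom A B) (hB : IsArch B) :
    f.ker.IsArchimedean := by
  rw [LIdeal.isArchimedean_iff]
  intro a b h
  rw [LHom.mem_ker, map_sup, map_zero, sup_eq_right]
  refine hB (f a) (f b) fun n => ?_
  have := h n
  rwa [LHom.mem_ker, map_sub, map_sup, map_nsmul, sub_eq_zero, sup_eq_right] at this

/-- A morphism from `F(A)` that vanishes on the defining relations extends to `H(A)`. -/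
noncomputable def HObj.desc {A : BAL.{u}} {B : Type u} [CommRing B] [Lattice B] [Algebra ℝ B]
    [LAlgebra B] (hB : IsArch B) (f : LHom (F A) B) (h : ∀ z, Rel A z → f z = 0) :
    LHom (HObj A) B :=
  (relIdeal A).liftHom f fun _ hz =>
    LIdeal.mem_archSpan.1 hz f.ker (f.ker_isArchimedean hB) h

section Relations

variable {A : BAL.{u}}

lemma quo_eq_zero_of_rel {z : F A} (hz : Rel A z) : (relIdeal A).quo z = 0 :=
  LIdeal.quo_eq_zero.2 (LIdeal.subset_archSpan hz)

lemma box_inf (a b : A) : box A (a ⊓ b) = box A a ⊓ box A b := by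
  have := quo_eq_zero_of_rel (Rel.inf a b)
  rw [map_sub, sub_eq_zero] at this
  exact this

lemma box_sup_zero (a : A) : box A (a ⊔ 0) = box A a ⊔ 0 := by
  have := quo_eq_zero_of_rel (Rel.pos a)
  rw [map_sub, sub_eq_zero] at this
  exact this

lemma box_algebraMap (r : ℝ) : box A (algebraMap ℝ A r) =
    algebraMap ℝ (HObj A) r + (1 - algebraMap ℝ (HObj A) r) * box A 0 := by
  have := quo_eq_zero_of_rel (Rel.const (A := A) r)
  rw [map_sub, map_sub, map_mul, map_sub, map_one, sub_sub, sub_eq_zero] at this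
  exact this

lemma box_add_algebraMap (a : A) (r : ℝ) : box A (a + algebraMap ℝ A r) =
    box A a + box A (algebraMap ℝ A r) - box A 0 := by
  have := quo_eq_zero_of_rel (Rel.add a r)
  rw [map_add, map_sub, map_sub] at this
  refine sub_eq_zero.1 (Eq.trans ?_ this)
  change box A (a + algebraMap ℝ A r) - _ = box A (a + algebraMap ℝ A r) - box A a -
    box A (algebraMap ℝ A r) + box A 0
  ring

lemma box_smul {r : ℝ} (hr : 0 ≤ r) (a : A) :
    box A (r • a) = box A (algebraMap ℝ A r) * box A a := by
  have := quo_eq_zero_of_rel (Rel.mul r a hr)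
  rw [map_sub, map_mul, sub_eq_zero] at this
  exact this

end Relations

variable (A : BAL.{u})

/-- The function on the Vietoris space of `Y_A` that sends `K` to the infimum of `a` on `K`. -/
noncomputable def infFun (a : A) : C(Compacts (Yosida A), ℝ) :=
  ⟨infOn (gelfand A a), continuous_infOn _⟩

lemma infFun_isWeighted : IsWeighted (wt A) (infFun A) := fun a => by
  rw [nrm_continuousMap, ContinuousMap.norm_le _ (NNReal.coe_nonneg _)]
  intro K
  refine (abs_infOn_le _ K).trans ?_
  rw [← nrm_gelfand A.arch]
  exact le_rfl

/-- The morphism `F(A) → C(V(Y_A))` induced by `infFun`. -/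
noncomputable def freeToVietoris : LHom (F A) C(Compacts (Yosida A), ℝ) :=
  Free.lift (B := BAL.of C(Compacts (Yosida A), ℝ) (continuousMap_isArch _)) (infFun A)
    (infFun_isWeighted A)

lemma freeToVietoris_fMap (a : A) : freeToVietoris A (fMap A a) = infFun A a := rfl

lemma freeToVietoris_rel {z : F A} (hz : Rel A z) : freeToVietoris A z = 0 := by
  refine ContinuousMap.ext fun K => ?_
  have halg : ∀ r : ℝ, algebraMap ℝ C(Compacts (Yosida A), ℝ) r K = r := fun r => by
    rw [algebraMap_apply]
    simp
  have hfun : ∀ a, infFun A a K = infOn (gelfand A a) K := fun _ => rfl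
  rw [ContinuousMap.zero_apply]
  cases hz with
  | inf a b =>
    rw [map_sub, map_inf, ContinuousMap.sub_apply, ContinuousMap.inf_apply]
    simp only [freeToVietoris_fMap, hfun]
    rw [map_inf, infOn_inf, sub_self]
  | pos a =>
    rw [map_sub, map_sup, map_zero, ContinuousMap.sub_apply, ContinuousMap.sup_apply]
    simp only [freeToVietoris_fMap, hfun]
    rw [map_sup, map_zero, infOn_sup_zero, ContinuousMap.zero_apply, sub_self]
  | const r =>
    rw [map_sub, map_sub, map_mul, map_sub, map_one, LHom.map_alg]
    simp only [ContinuousMap.sub_apply, ContinuousMap.mul_apply, ContinuousMap.one_apply,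
      freeToVietoris_fMap, hfun, halg]
    rw [LHom.map_alg, map_zero]
    by_cases hK : (K : Set (Yosida A)).Nonempty
    · rw [infOn_algebraMap r hK, infOn_zero hK]
      ring
    · rw [infOn_of_empty hK, infOn_of_empty hK]
      ring
  | add a r =>
    rw [map_add, map_sub, map_sub]
    simp only [ContinuousMap.sub_apply, ContinuousMap.add_apply, freeToVietoris_fMap, hfun]
    rw [map_add, LHom.map_alg, map_zero]
    by_cases hK : (K : Set (Yosida A)).Nonempty
    · rw [infOn_add_algebraMap _ r hK, infOn_algebraMap r hK, infOn_zero hK]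
      ring
    · rw [infOn_of_empty hK, infOn_of_empty hK, infOn_of_empty hK, infOn_of_empty hK]
      ring
  | mul r a hr =>
    rw [map_sub, map_mul]
    simp only [ContinuousMap.sub_apply, ContinuousMap.mul_apply, freeToVietoris_fMap, hfun]
    rw [map_smul, LHom.map_alg]
    by_cases hK : (K : Set (Yosida A)).Nonempty
    · rw [infOn_smul hr _ hK, infOn_algebraMap r hK, sub_self]
    · rw [infOn_of_empty hK, infOn_of_empty hK, infOn_of_empty hK]
      ring

/-- The morphism `H(A) → C(V(Y_A))` that sends `box a` to `infFun a`. -/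
noncomputable def toVietoris : LHom (HObj A) C(Compacts (Yosida A), ℝ) :=
  HObj.desc (continuousMap_isArch _) (freeToVietoris A) fun _ => freeToVietoris_rel A

lemma toVietoris_box (a : A) : toVietoris A (box A a) = infFun A a := rfl

/-- The comparison map `V(Y_A) → Y_{H(A)}`. -/
noncomputable def vietorisMap : C(Compacts (Yosida A), Yosida (HObj A)) :=
  (yosidaMap (toVietoris A)).comp (evalMap _)

variable {A}

lemma mem_vietorisMap {K : Compacts (Yosida A)} {z : HObj A} :
    z ∈ (vietorisMap A K).1 ↔ toVietoris A z K = 0 := Iff.rfl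

lemma gelfand_vietorisMap (z : HObj A) (K : Compacts (Yosida A)) :
    gelfand (HObj A) z (vietorisMap A K) = toVietoris A z K := by
  refine val_eq ?_
  rw [mem_vietorisMap, map_sub, LHom.map_alg, ContinuousMap.sub_apply, algebraMap_apply]
  simp

/-- Maximal `ℓ`-ideals of `H(A)` are determined by the values of the elements `box a`. -/
lemma yosida_HObj_ext {M N : Yosida (HObj A)}
    (h : ∀ a, gelfand (HObj A) (box A a) M = gelfand (HObj A) (box A a) N) : M = N := by
  have key : (gelfand (HObj A)).comp (compHom (ContinuousMap.const PUnit.{u + 1} M)) =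
      (gelfand (HObj A)).comp (compHom (ContinuousMap.const PUnit.{u + 1} N)) :=
    HObj.hom_ext fun a => ContinuousMap.ext fun _ => h a
  refine Yosida.ext (LIdeal.ext' fun z => ?_)
  rw [← gelfand_eq_zero, ← gelfand_eq_zero]
  have := DFunLike.congr_fun (DFunLike.congr_fun key z) PUnit.unit
  exact (congrArg (· = 0) this).to_iff

lemma vietorisMap_injective (A : UBAL.{u}) : Function.Injective (vietorisMap A.obj) := by
  intro K L hKL
  refine infOn_ext fun f => ?_
  obtain ⟨a, rfl⟩ := gelfand_surjective A f
  have h1 := gelfand_vietorisMap (box A.obj a) K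
  rw [hKL, gelfand_vietorisMap] at h1
  exact h1.symm

lemma vietorisMap_surjective (A : UBAL.{u}) : Function.Surjective (vietorisMap A.obj) := by
  intro N
  let e := gelfandEquiv A
  have he : ∀ a, e a = gelfand A.obj a := fun _ => rfl
  have hes : ∀ a, e.symm (gelfand A.obj a) = a := e.symm_apply_apply
  let q : A.obj → ℝ := fun a => gelfand (HObj A.obj) (box A.obj a) N
  let p : C(Yosida A.obj, ℝ) → ℝ := fun f => q (e.symm f)
  have hpq : ∀ a, p (gelfand A.obj a) = q a := fun a => congrArg q (hes a)
  suffices h : ∃ K : Compacts (Yosida A.obj), ∀ f, infOn f K = p f by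
    obtain ⟨K, hK⟩ := h
    refine ⟨K, yosida_HObj_ext fun a => ?_⟩
    rw [gelfand_vietorisMap]
    exact (hK _).trans (hpq a)
  have halg : ∀ r : ℝ, algebraMap ℝ C(Yosida (HObj A.obj), ℝ) r N = r := fun r => by
    rw [algebraMap_apply]
    simp
  have qinf : ∀ a b, q (a ⊓ b) = q a ⊓ q b := fun a b => by
    simp only [q]
    rw [box_inf, map_inf, ContinuousMap.inf_apply]
  have qpos : ∀ a, q (a ⊔ 0) = q a ⊔ 0 := fun a => by
    simp only [q]
    rw [box_sup_zero, map_sup, map_zero, ContinuousMap.sup_apply, ContinuousMap.zero_apply]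
  have qalg : ∀ r : ℝ, q (algebraMap ℝ A.obj r) = r + (1 - r) * q 0 := fun r => by
    simp only [q]
    rw [box_algebraMap, map_add, map_mul, map_sub, map_one, LHom.map_alg]
    simp only [ContinuousMap.sub_apply, ContinuousMap.add_apply, ContinuousMap.mul_apply,
      ContinuousMap.one_apply, halg]
  have qadd : ∀ a (r : ℝ), q (a + algebraMap ℝ A.obj r) = q a + q (algebraMap ℝ A.obj r) - q 0 :=
    fun a r => by
      simp only [q]
      rw [box_add_algebraMap, map_sub, map_add]
      rfl
  have qsmul : ∀ (r : ℝ) a, 0 ≤ r → q (r • a) = q (algebraMap ℝ A.obj r) * q a :=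
    fun r a hr => by
      simp only [q]
      rw [box_smul hr, map_mul]
      rfl
  have q0 : ∀ a, q 0 = q 0 * q a := fun a => by
    have := qsmul 0 a le_rfl
    rwa [zero_smul, map_zero] at this
  by_cases h0 : q 0 = 0
  · have psurj : ∀ f, ∃ a, gelfand A.obj a = f := gelfand_surjective A
    have qalg' : ∀ r : ℝ, q (algebraMap ℝ A.obj r) = r := fun r => by
      rw [qalg, h0, mul_zero, add_zero]
    have att := exists_lowerBound_attained (p := p)
      (fun f g => by
        obtain ⟨a, rfl⟩ := psurj f
        obtain ⟨b, rfl⟩ := psurj g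
        rw [← map_inf, hpq, hpq, hpq, qinf])
      (fun f => by
        obtain ⟨a, rfl⟩ := psurj f
        rw [← map_zero (gelfand A.obj), ← map_sup, hpq, hpq, qpos])
      (fun f r => by
        obtain ⟨a, rfl⟩ := psurj f
        rw [← LHom.map_alg (gelfand A.obj), ← map_add, hpq, hpq, qadd, qalg', h0, sub_zero])
      (fun r f hr => by
        obtain ⟨a, rfl⟩ := psurj f
        rw [← map_smul, hpq, hpq, qsmul r a hr, qalg'])
    have hcl : IsClosed {x | ∀ b : C(Yosida A.obj, ℝ), p b ≤ b x} := by
      have : {x | ∀ b : C(Yosida A.obj, ℝ), p b ≤ b x} = ⋂ b, {x | p b ≤ b x} := by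
        ext x
        simp
      rw [this]
      exact isClosed_iInter fun b => isClosed_le continuous_const b.continuous
    let K : Compacts (Yosida A.obj) := ⟨_, hcl.isCompact⟩
    have hK : ∀ y, y ∈ K ↔ ∀ b, p b ≤ b y := fun _ => Iff.rfl
    refine ⟨K, fun f => ?_⟩
    obtain ⟨x, hx, hfx⟩ := att f
    rw [infOn_eq_of_forall_le ((hK x).2 hx) fun y hy => hfx.trans ((hK y).1 hy f)]
    exact le_antisymm hfx (hx f)
  · refine ⟨⊥, fun f => ?_⟩
    rw [infOn_of_empty (by simp)]
    exact mul_left_cancel₀ h0 (by rw [mul_one]; exact q0 _)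

/-- The Yosida space of `H(A)` is the Vietoris space of the Yosida space of `A`. -/
noncomputable def vietorisHomeo (A : UBAL.{u}) :
    Compacts (Yosida A.obj) ≃ₜ Yosida (HObj A.obj) :=
  (vietorisMap A.obj).continuous.homeoOfEquivCompactToT2
    (f := Equiv.ofBijective (vietorisMap A.obj)
      ⟨vietorisMap_injective A, vietorisMap_surjective A⟩)

/-- The comparison map `V(Y_A) → Y_{H(A)}` is natural. -/
lemma vietorisMap_naturality {A B : BAL.{u}} (f : LHom A B) (K : Compacts (Yosida B)) :
    yosidaMap (A := HObj A) (B := HObj B) (HMap (A := A) (B := B) f) (vietorisMap B K) =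
      vietorisMap A (K.map (yosidaMap f) (yosidaMap f).continuous) := by
  refine yosida_HObj_ext fun a => ?_
  rw [← gelfand_map, HMap_box, gelfand_vietorisMap, gelfand_vietorisMap, toVietoris_box,
    toVietoris_box]
  change infOn _ _ = infOn _ _
  rw [infOn_map]
  congr 1
  exact ContinuousMap.ext fun N => gelfand_map f a N

end YosidaH

end Bal

namespace Bal

/-! ### Algebras and coalgebras under a dual equivalence -/

section AlgebraCoalgebra

open Opposite

variable {𝒜 : Type*} [Category 𝒜] {ℰ : Type*} [Category ℰ] {T : 𝒜 ⥤ 𝒜} {S : ℰ ⥤ ℰ}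
  {D : 𝒜ᵒᵖ ⥤ ℰ} (φ : T.op ⋙ D ≅ D ⋙ S)

/-- A contravariant functor that intertwines two endofunctors sends algebras to coalgebras. -/
def algebraToCoalgebra : (Endofunctor.Algebra T)ᵒᵖ ⥤ Endofunctor.Coalgebra S where
  obj A := { V := D.obj (op A.unop.a), str := D.map A.unop.str.op ≫ φ.hom.app (op A.unop.a) }
  map {A B} f :=
    { f := D.map f.unop.f.op
      h := by
        have h1 := φ.hom.naturality f.unop.f.op
        have h2 := congrArg (fun g => D.map g.op) f.unop.h
        simp only [Functor.comp_map, Functor.op_map, Quiver.Hom.unop_op, op_comp,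
          Functor.map_comp] at h1 h2
        rw [Category.assoc, ← h1, ← Category.assoc, h2, Category.assoc] }
  map_id A := by
    exact Endofunctor.Coalgebra.Hom.ext (D.map_id _)
  map_comp f g := by
    exact Endofunctor.Coalgebra.Hom.ext (D.map_comp f.unop.f.op g.unop.f.op)

instance [D.Faithful] : (algebraToCoalgebra φ).Faithful where
  map_injective {A B f g} h := by
    have h1 : D.map f.unop.f.op = D.map g.unop.f.op := congrArg Endofunctor.Coalgebra.Hom.f h
    exact Quiver.Hom.unop_inj (Endofunctor.Algebra.Hom.ext (Quiver.Hom.op_inj (D.map_injective h1)))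

instance [D.Full] [D.Faithful] : (algebraToCoalgebra φ).Full where
  map_surjective {A B} g := by
    obtain ⟨k, hk⟩ := D.map_surjective (X := op A.unop.a) (Y := op B.unop.a) g.f
    have hg : D.map A.unop.str.op ≫ φ.hom.app (op A.unop.a) ≫ S.map (D.map k) =
        D.map k ≫ D.map B.unop.str.op ≫ φ.hom.app (op B.unop.a) := by
      rw [hk]
      exact (Category.assoc _ _ _).symm.trans g.h
    refine ⟨Quiver.Hom.op { f := k.unop, h := ?_ }, Endofunctor.Coalgebra.Hom.ext hk⟩
    refine Quiver.Hom.op_inj (D.map_injective ?_)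
    have h1 := φ.hom.naturality k
    simp only [Functor.comp_map, Functor.op_map] at h1
    rw [← h1, ← Category.assoc, ← Category.assoc, cancel_mono] at hg
    simpa only [op_comp, Functor.map_comp, Quiver.Hom.op_unop] using hg

instance [D.Full] [D.EssSurj] : (algebraToCoalgebra φ).EssSurj where
  mem_essImage V := by
    let i : D.obj (op (D.objPreimage V.V).unop) ≅ V.V := D.objObjPreimageIso V.V
    obtain ⟨k, hk⟩ := D.map_surjective (X := op (D.objPreimage V.V).unop)
      (Y := op (T.obj (D.objPreimage V.V).unop))
      (i.hom ≫ V.str ≫ S.map i.inv ≫ φ.inv.app (op (D.objPreimage V.V).unop))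
    refine ⟨op { a := (D.objPreimage V.V).unop, str := k.unop },
      ⟨Endofunctor.Coalgebra.isoMk i ?_⟩⟩
    change (D.map k ≫ φ.hom.app _) ≫ S.map i.hom = i.hom ≫ V.str
    rw [hk]
    simp only [Category.assoc, Iso.inv_hom_id_app_assoc]
    rw [← S.map_comp, i.inv_hom_id, S.map_id, Category.comp_id]

instance [D.IsEquivalence] : (algebraToCoalgebra φ).IsEquivalence where

end AlgebraCoalgebra

/-! ### Gelfand duality for clean algebras and Stone spaces -/

instance (A : CUBAL.{u}) : TotallyDisconnectedSpace (Yosida A.obj.obj) :=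
  totallyDisconnected_of_isClean A.property

/-- The Yosida functor from clean algebras to Stone spaces. -/
def stoneY : CUBAL.{u}ᵒᵖ ⥤ Profinite.{u} where
  obj A := Profinite.of (Yosida A.unop.obj.obj)
  map f := CompHausLike.ofHom _ (yosidaMap f.unop.hom.hom)

/-- The morphism of algebras dual to a continuous map of Yosida spaces. -/
noncomputable def dualHom {A B : UBAL.{u}} (φ : C(Yosida B.obj, Yosida A.obj)) :
    LHom A.obj B.obj where
  toFun a := (gelfandEquiv B).symm ((gelfand A.obj a).comp φ)
  map_one' := by
    rw [map_one]
    exact map_one (gelfandEquiv B).symm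
  map_mul' a b := by
    rw [map_mul]
    exact map_mul (gelfandEquiv B).symm ((gelfand A.obj a).comp φ) ((gelfand A.obj b).comp φ)
  map_zero' := by
    rw [map_zero]
    exact map_zero (gelfandEquiv B).symm
  map_add' a b := by
    rw [map_add]
    exact map_add (gelfandEquiv B).symm ((gelfand A.obj a).comp φ) ((gelfand A.obj b).comp φ)
  commutes' r := by
    rw [RingEquiv.symm_apply_eq]
    refine Eq.trans ?_ (LHom.map_alg (gelfand B.obj) r).symm
    rw [LHom.map_alg]
    rfl
  map_sup' a b := by
    rw [RingEquiv.symm_apply_eq, map_sup]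
    refine Eq.trans ?_ (map_sup (gelfand B.obj) _ _).symm
    exact congrArg₂ (· ⊔ ·) ((gelfandEquiv B).apply_symm_apply ((gelfand A.obj a).comp φ)).symm
      ((gelfandEquiv B).apply_symm_apply ((gelfand A.obj b).comp φ)).symm
  map_inf' a b := by
    rw [RingEquiv.symm_apply_eq, map_inf]
    refine Eq.trans ?_ (map_inf (gelfand B.obj) _ _).symm
    exact congrArg₂ (· ⊓ ·) ((gelfandEquiv B).apply_symm_apply ((gelfand A.obj a).comp φ)).symm
      ((gelfandEquiv B).apply_symm_apply ((gelfand A.obj b).comp φ)).symm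

lemma gelfand_dualHom {A B : UBAL.{u}} (φ : C(Yosida B.obj, Yosida A.obj)) (a : A.obj) :
    gelfand B.obj (dualHom φ a) = (gelfand A.obj a).comp φ :=
  (gelfandEquiv B).apply_symm_apply _

lemma yosidaMap_dualHom {A B : UBAL.{u}} (φ : C(Yosida B.obj, Yosida A.obj)) :
    yosidaMap (dualHom φ) = φ := by
  refine ContinuousMap.ext fun N => Yosida.ext (LIdeal.ext' fun a => ?_)
  rw [← gelfand_eq_zero, ← gelfand_eq_zero, ← gelfand_map, gelfand_dualHom]
  rfl

lemma yosidaMap_injective {A B : UBAL.{u}} {f g : LHom A.obj B.obj}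
    (h : yosidaMap f = yosidaMap g) : f = g := by
  refine LHom.ext fun a => gelfand_injective B.obj.arch (ContinuousMap.ext fun N => ?_)
  rw [gelfand_map, gelfand_map, h]

instance : stoneY.{u}.Faithful where
  map_injective {A B f g} h := by
    have h1 : yosidaMap f.unop.hom.hom = yosidaMap g.unop.hom.hom :=
      congrArg (fun k => k.hom.hom) h
    exact Quiver.Hom.unop_inj (ObjectProperty.hom_ext _ (ObjectProperty.hom_ext _
      (yosidaMap_injective (A := B.unop.obj) (B := A.unop.obj) h1)))

instance : stoneY.{u}.Full where
  map_surjective {A B} k := by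
    refine ⟨Quiver.Hom.op (ObjectProperty.homMk (ObjectProperty.homMk
      (dualHom (A := B.unop.obj) (B := A.unop.obj) k.hom.hom))), ?_⟩
    refine ConcreteCategory.hom_ext _ _ fun N => ?_
    exact DFunLike.congr_fun
      (yosidaMap_dualHom (A := B.unop.obj) (B := A.unop.obj) k.hom.hom) N

instance : stoneY.{u}.EssSurj where
  mem_essImage X := ⟨Opposite.op ⟨CObj (profiniteToCompHaus.obj X),
      @isClean_CObj _ (inferInstanceAs (TotallyDisconnectedSpace X))⟩,
    ⟨CompHausLike.isoOfHomeo (evalHomeo X).symm⟩⟩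

instance : stoneY.{u}.IsEquivalence where

/-! ### The duality between algebras for `Hᶜ` and coalgebras for the Vietoris functor -/

lemma isClean_Hu (A : CUBAL.{u}) : IsClean (Hu.obj A.obj) := by
  have : TotallyDisconnectedSpace (Yosida (HObj A.obj.obj)) :=
    (vietorisHomeo A.obj).totallyDisconnectedSpace
  exact isClean_CObj (CompHaus.of (Yosida (HObj A.obj.obj)))

/-- The Vietoris functor corresponds to `Hᶜ` under Gelfand duality. -/
noncomputable def stoneYVietorisIso : stoneY.{u} ⋙ VS ≅ (Hc isClean_Hu).op ⋙ stoneY :=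
  NatIso.ofComponents
    (fun A => CompHausLike.isoOfHomeo
      ((vietorisHomeo A.unop.obj).trans (evalHomeo (Yosida (HObj A.unop.obj.obj)))))
    (fun {A B} f => by
      refine ConcreteCategory.hom_ext _ _ fun K => ?_
      exact congrArg (evalMap (Yosida (HObj B.unop.obj.obj)))
        (vietorisMap_naturality f.unop.hom.hom K).symm)

end Bal

theorem mainTheorem11 :
    ∃ hclean : ∀ A : Bal.CUBAL.{u}, Bal.IsClean (Bal.Hu.obj A.obj),
      ∃ e : (Endofunctor.Algebra (Bal.Hc hclean))ᵒᵖ ≌ Endofunctor.Coalgebra Bal.VS.{u},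
        Nonempty (e.functor ⋙ Endofunctor.Coalgebra.forget Bal.VS ⋙ profiniteToCompHaus ≅
          (Endofunctor.Algebra.forget (Bal.Hc hclean)).op ⋙ (ObjectProperty.ι Bal.IsClean).op ⋙
            (ObjectProperty.ι Bal.IsUniformlyComplete).op ⋙ Bal.Y) := by
  refine ⟨Bal.isClean_Hu,
    (Bal.algebraToCoalgebra Bal.stoneYVietorisIso.symm).asEquivalence, ⟨?_⟩⟩
  exact NatIso.ofComponents (fun _ => Iso.refl _)
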